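/- Let $k\in\mathbb N$ and let $\Lambda$ (also written $\mathbb F_\theta^+$) be a single-vertex $k$-graph, i.e. a unital semigroup with a degree homomorphism $d:\Lambda\to\mathbb N^k$ such that whenever $d(w)=p+q$ there are unique $u,v\in\Lambda$ with $w=uv$, $d(u)=p$, $d(v)=q$. Let $\varepsilon_1,\dots,\varepsilon_k$ be the standard generators of $\mathbb N^k$; elements of degree $\varepsilon_i$ are called edges of colour $i$. Assume that the number $m_i$ of edges of colour $i$ is finite and $m_i>1$ for every $1\le i\le k$. Write $m^p=\prod_i m_i^{p_i}$ for $p\in\mathbb Z^k$. Let $\mathcal O_\theta$ be the universal unital C*-algebra generated by a representation $w\mapsto s_w$ of the semigroup $\Lambda$ (with $s_1=1$) such that, for every colour $i$, one has $s_e^*s_f=\delta_{e,f}1$ for edges $e,f$ of colour $i$, and $\sum_{e} s_es_e^*=1$, the sum being over the edges $e$ of colour $i$. Let $\gamma_t$ ($t\in\mathbb T^k$) be the gauge automorphisms, $\gamma_t(s_w)=t^{d(w)}s_w$, let $\mathfrak F=\mathcal O_\theta^\gamma$ be their fixed point algebra (the UHF core), and let $\Phi_0(A)=\int_{\mathbb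 T^k}\gamma_t(A)\,dt$, the integral being with respect to normalized Haar measure. Then $\mathfrak F$ has a unique tracial state $\tau$; put $\omega=\tau\circ\Phi_0$. The modular automorphism group of $\omega$ on $\mathcal O_\theta$ is the action $\sigma$ of $\mathbb R$ with $\sigma_t(s_us_v^*)=m^{it(d(v)-d(u))}s_us_v^*$ for $u,v\in\Lambda$, $t\in\mathbb R$: it is a strongly continuous one-parameter group of automorphisms that preserves $\omega$ and satisfies the modular (KMS) condition, i.e. for all $A,B\in\mathcal O_\theta$ there is a bounded continuous function $F$ on $\{0\le\operatorname{Im}z\le1\}$, analytic in the interior, with $F(t)=\omega(\sigma_t(A)B)$ and $F(t+i)=\omega(B\sigma_t(A))$ for all $t\in\mathbb R$. Let $\mathcal O_\theta^\sigma=\{A\in\mathcal O_\theta:\sigma_t(A)=A\text{ for all }t\in\mathbb R\}\supseteq\mathfrak F$. Suppose that at least one of the following holds: (a) $\Lambda$ has the little pull-back property: whenever $e,f$ are edges of distinct colours, there is at most one pair $(\xi,\eta)\in\Lambda\times\Lambda$ with $e\xi=f\eta$ and $d(e\xi)=d(e)\vee d(f)$; (b) the intrinsic group $G=\{g\in\mathbb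 Z^k: m^g=1\}$ has rank $0$. Then $\mathcal O_\theta^\sigma$ has a unique tracial state, and this tracial state extends $\tau$. -/

import Mathlib

open scoped ENNReal

universe u v

/-- A single-vertex `k`-graph: a `k`-graph (small category with a degree map to `ℕ^k` satisfying
the factorization property) with exactly one object, i.e. a monoid `Λ` with a degree homomorphism
`d : Λ → ℕ^k` and unique factorizations, with finitely many edges of every colour. -/
structure SingleVertexKGraph (k : ℕ) (Λ : Type u) [Monoid Λ] where
  d : Λ → Fin k → ℕ
  d_one : d 1 = 0
  d_mul : ∀ u v : Λ, d (u * v) = d u + d v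
  factorization : ∀ (w : Λ) (p q : Fin k → ℕ), d w = p + q →
    ∃! x : Λ × Λ, w = x.1 * x.2 ∧ d x.1 = p ∧ d x.2 = q
  finite_edges : ∀ i : Fin k, Finite {e : Λ // d e = Pi.single i 1}

namespace SingleVertexKGraph

variable {k : ℕ} {Λ : Type u} [Monoid Λ] (G : SingleVertexKGraph k Λ)

/-- The edges of colour `i`: the elements of degree `ε_i`. -/
abbrev Edge (i : Fin k) : Type u := {e : Λ // G.d e = Pi.single i 1}

noncomputable instance edgeFintype (i : Fin k) : Fintype (G.Edge i) :=
  haveI := G.finite_edges i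
  Fintype.ofFinite _

/-- The number `m_i` of edges of colour `i`. -/
noncomputable def m (i : Fin k) : ℕ := Fintype.card (G.Edge i)

/-- `Λ^min(μ, ν)`: the pairs `(ξ, η)` with `μ ξ = ν η` of degree `d(μ) ∨ d(ν)`. -/
def minExt (μ ν : Λ) : Set (Λ × Λ) :=
  {x | μ * x.1 = ν * x.2 ∧ G.d (μ * x.1) = G.d μ ⊔ G.d ν}

/-- The little pull-back property: `|Λ^min(e, f)| ≤ 1` for all edges `e`, `f` of distinct
degrees. -/
def LittlePullback : Prop :=
  ∀ i j : Fin k, i ≠ j → ∀ (e : G.Edge i) (f : G.Edge j),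
    (G.minExt (e : Λ) (f : Λ)).encard ≤ 1

/-- The intrinsic group `{g ∈ ℤ^k | ∏ i, m_i ^ g_i = 1}`. -/
def intrinsicGroup : AddSubgroup (Fin k → ℤ) where
  carrier := {g | ∏ i, (G.m i : ℝ) ^ (g i) = 1}
  zero_mem' := by simp
  add_mem' := by
    intro a b ha hb
    simp only [Set.mem_ofPred_eq] at ha hb ⊢
    have h : ∀ c : Fin k → ℤ, ∏ i, (G.m i : ℝ) ^ (c i) = 1 → ∀ i, (G.m i : ℝ) = 0 → c i = 0 := by
      intro c hc i hi
      by_contra h0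
      have : ∏ i, (G.m i : ℝ) ^ (c i) = 0 :=
        Finset.prod_eq_zero (Finset.mem_univ i) (by rw [hi, zero_zpow _ h0])
      rw [this] at hc
      exact zero_ne_one hc
    rw [← mul_one (1 : ℝ)]
    nth_rewrite 1 [← ha]
    rw [← hb, ← Finset.prod_mul_distrib]
    refine Finset.prod_congr rfl fun i _ => ?_
    by_cases hi : (G.m i : ℝ) = 0
    · simp [h a ha i hi, h b hb i hi]
    · rw [Pi.add_apply, zpow_add₀ hi]
  neg_mem' := by
    intro a ha
    simp only [Set.mem_ofPred_eq, Pi.neg_apply, zpow_neg, Finset.prod_inv_distrib] at ha ⊢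
    rw [ha, inv_one]

/-- A representation `S` of the semigroup `Λ` in a C*-algebra (a monoid homomorphism; since the
edges generate `Λ` subject only to the relations `e f = f' e'` between edges of two colours, this is
the same as a family of elements indexed by the edges satisfying these commutation relations) is
of Cuntz type if, for every colour `i`, the elements `S_e` with `e` of colour `i` satisfy
`S_e^* S_f = δ_{e,f}` and `∑ S_e S_e^* = 1`. -/
structure IsCuntzType {A : Type v} [Ring A] [StarRing A] (S : Λ →* A) : Prop where
  star_mul_self : ∀ (i : Fin k) (e : G.Edge i), star (S e) * S e = 1
  star_mul_of_ne : ∀ (i : Fin k) (e f : G.Edge i), e ≠ f → star (S e) * S f = 0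
  sum_mul_star : ∀ i : Fin k, ∑ e : G.Edge i, S e * star (S e) = 1

lemma eq_one_of_d_eq_zero {w : Λ} (h : G.d w = 0) : w = 1 := by
  obtain ⟨x, -, hx⟩ := G.factorization w 0 0 (by simpa using h)
  have h1 := hx (w, 1) ⟨by simp, h, G.d_one⟩
  have h2 := hx (1, w) ⟨by simp, G.d_one, h⟩
  exact congrArg Prod.fst (h1.trans h2.symm)

/-- The edges generate `Λ`. -/
lemma edge_induction {P : Λ → Prop} (h1 : P 1)
    (hmul : ∀ (i : Fin k) (e : G.Edge i) (w : Λ), P w → P ((e : Λ) * w)) (w : Λ) : P w := by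
  induction hn : ∑ i, G.d w i using Nat.strong_induction_on generalizing w with
  | _ n ih =>
    by_cases h0 : G.d w = 0
    · rw [G.eq_one_of_d_eq_zero h0]; exact h1
    · obtain ⟨i, hi⟩ := Function.ne_iff.1 h0
      have hle : Pi.single i 1 ≤ G.d w := by
        intro j
        by_cases hj : j = i
        · subst hj
          simpa [Nat.one_le_iff_ne_zero] using hi
        · simp [hj]
      obtain ⟨x, ⟨hw, hx1, hx2⟩, -⟩ := G.factorization w (Pi.single i 1) (G.d w - Pi.single i 1)
        (add_tsub_cancel_of_le hle).symm
      rw [hw]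
      refine hmul i ⟨x.1, hx1⟩ x.2 (ih _ ?_ x.2 rfl)
      rw [← hn, hw]
      refine Finset.sum_lt_sum (fun j _ => by simp [G.d_mul]) ⟨i, Finset.mem_univ i, ?_⟩
      rw [G.d_mul, Pi.add_apply, hx1]
      simp

lemma IsCuntzType.isometry {G : SingleVertexKGraph k Λ} {A : Type v} [Ring A] [StarRing A]
    {S : Λ →* A} (hS : G.IsCuntzType S) (w : Λ) : star (S w) * S w = 1 := by
  induction w using G.edge_induction with
  | h1 => simp
  | hmul i e w ih =>
    rw [map_mul, star_mul, mul_assoc, ← mul_assoc (star (S e)), hS.star_mul_self, one_mul, ih]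

/-- Cuntz-type representations of `Λ` in (nonzero, unital) C*-algebras. C*-algebras in the lowest
universe suffice: a C*-algebra generated by such a representation is separable, so it has at most
continuum many elements (see `existsUnique_lift`, where the universe is arbitrary). -/
structure Rep : Type (max u 1) where
  B : Type
  [cstar : CStarAlgebra B]
  [nontriv : Nontrivial B]
  S : Λ →* B
  isCuntz : G.IsCuntzType S

attribute [instance] Rep.cstar Rep.nontriv

/-- The C*-algebra of bounded families indexed by all Cuntz-type representations. -/
abbrev BoundedFamilies : Type (max u 1) := lp (fun R : G.Rep => R.B) ∞

noncomputable instance : CStarAlgebra G.BoundedFamilies where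

lemma Rep.norm_le {G : SingleVertexKGraph k Λ} (R : G.Rep) (w : Λ) : ‖R.S w‖ ≤ 1 := by
  have h : ‖R.S w‖ * ‖R.S w‖ = 1 := by
    rw [← CStarRing.norm_star_mul_self, R.isCuntz.isometry, CStarRing.norm_one]
  nlinarith [norm_nonneg (R.S w)]

/-- The universal Cuntz-type representation `w ↦ (S_w)_S`. -/
noncomputable def univRep : Λ →* G.BoundedFamilies where
  toFun w := ⟨fun R => R.S w, memℓp_infty ⟨1, by rintro _ ⟨R, rfl⟩; exact R.norm_le w⟩⟩
  map_one' := by ext R; simp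
  map_mul' u v := by ext R; simp

/-- The C*-algebra generated by the universal Cuntz-type representation. -/
noncomputable def algSub : StarSubalgebra ℂ G.BoundedFamilies :=
  (StarAlgebra.adjoin ℂ (Set.range G.univRep)).topologicalClosure

/-- The `k`-graph C*-algebra `O_θ`: the universal C*-algebra for Cuntz-type representations. -/
abbrev Alg : Type (max u 1) := G.algSub

instance : IsClosed (G.algSub : Set G.BoundedFamilies) :=
  StarSubalgebra.isClosed_topologicalClosure _

noncomputable instance : CStarAlgebra G.Alg := inferInstance

/-- The generators `s_w`, `w ∈ Λ`, of `O_θ`. -/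
noncomputable def s : Λ →* G.Alg where
  toFun w := ⟨G.univRep w, StarSubalgebra.le_topologicalClosure _
    (StarAlgebra.subset_adjoin ℂ _ ⟨w, rfl⟩)⟩
  map_one' := Subtype.ext (map_one G.univRep)
  map_mul' u v := Subtype.ext (map_mul G.univRep u v)

lemma s_coe_apply (w : Λ) (R : G.Rep) : ((G.s w : G.Alg) : G.BoundedFamilies) R = R.S w := rfl

lemma s_isCuntzType : G.IsCuntzType G.s where
  star_mul_self i e := by
    ext R
    exact R.isCuntz.star_mul_self i e
  star_mul_of_ne i e f h := by
    ext R
    exact R.isCuntz.star_mul_of_ne i e f h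
  sum_mul_star i := by
    ext R
    have h := R.isCuntz.sum_mul_star i
    rw [AddSubmonoidClass.coe_finsetSum, lp.coeFn_sum, Finset.sum_apply]
    exact h

/-- *-homomorphisms on `O_θ` are determined by their values on the generators. -/
lemma hom_ext {A : Type v} [CStarAlgebra A] {φ ψ : G.Alg →⋆ₐ[ℂ] A}
    (h : ∀ w, φ (G.s w) = ψ (G.s w)) : φ = ψ := by
  have hc : ∀ χ : G.Alg →⋆ₐ[ℂ] A, Continuous χ := fun χ =>
    AddMonoidHomClass.continuous_of_bound χ 1 fun x => by
      simpa using NonUnitalStarAlgHom.norm_apply_le χ x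
  refine StarAlgHom.ext_topologicalClosure (hc φ) (hc ψ) ?_
  refine StarAlgHom.ext_adjoin fun x hx => ?_
  obtain ⟨w, hw⟩ := hx
  have : (StarSubalgebra.inclusion (StarSubalgebra.le_topologicalClosure _) x : G.Alg) = G.s w :=
    Subtype.ext hw.symm
  exact (congrArg φ this).trans ((h w).trans (congrArg ψ this).symm)

lemma countable_monoid (G : SingleVertexKGraph k Λ) : Countable Λ := by
  let f : List (Σ i, G.Edge i) → Λ := fun l => (l.map fun e => (e.2 : Λ)).prod
  have hf : Function.Surjective f := by
    intro w
    induction w using G.edge_induction with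
    | h1 => exact ⟨[], by simp [f]⟩
    | hmul i e w ih =>
      obtain ⟨l, rfl⟩ := ih
      exact ⟨⟨i, e⟩ :: l, by simp [f]⟩
  exact hf.countable

/-- Evaluation of `O_θ` at a Cuntz-type representation. -/
noncomputable def evalRep (R : G.Rep) : G.Alg →⋆ₐ[ℂ] R.B where
  toFun a := (a : G.BoundedFamilies) R
  map_one' := rfl
  map_mul' _ _ := rfl
  map_zero' := rfl
  map_add' _ _ := rfl
  commutes' _ := rfl
  map_star' _ := rfl

lemma exists_cstarAlgebra_equiv (C : Type v) [CStarAlgebra C] [Small.{0} C] :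
    ∃ (B : Type) (_ : CStarAlgebra B), Nonempty (B ≃⋆ₐ[ℂ] C) := by
  let e : Shrink.{0} C ≃ₐ[ℂ] C := Shrink.algEquiv ℂ C
  let n : NormedRing (Shrink.{0} C) := NormedRing.induced _ C e e.injective
  have hn : ∀ x : Shrink.{0} C, ‖x‖ = ‖e x‖ := fun _ => rfl
  have hiso : Isometry e := AddMonoidHomClass.isometry_of_norm e fun x => (hn x).symm
  let na : NormedAlgebra ℂ (Shrink.{0} C) :=
    { norm_smul_le := fun r x => by rw [hn, hn, map_smul]; exact norm_smul_le r _ }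
  let st : StarRing (Shrink.{0} C) :=
    { star := fun x => e.symm (star (e x))
      star_involutive := fun x => by simp
      star_mul := fun x y => by
        change e.symm (star (e (x * y))) = e.symm (star (e y)) * e.symm (star (e x))
        simp
      star_add := fun x y => by
        change e.symm (star (e (x + y))) = e.symm (star (e x)) + e.symm (star (e y))
        simp }
  have hstar : ∀ x : Shrink.{0} C, e (star x) = star (e x) := fun x => e.apply_symm_apply _
  have : CompleteSpace (Shrink.{0} C) :=
    (completeSpace_congr (e := e.toEquiv) hiso.isUniformEmbedding).2 inferInstance
  have : CStarRing (Shrink.{0} C) :=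
    { norm_mul_self_le := fun x => by
        rw [hn, hn, map_mul, hstar, CStarRing.norm_star_mul_self] }
  have : StarModule ℂ (Shrink.{0} C) :=
    { star_smul := fun r x => e.injective (by rw [hstar, map_smul, map_smul, star_smul, hstar]) }
  exact ⟨Shrink.{0} C, { }, ⟨StarAlgEquiv.ofAlgEquiv e hstar⟩⟩

lemma small_closure_adjoin {A : Type v} [CStarAlgebra A] (f : ℕ → A) :
    Small.{0} (StarAlgebra.adjoin ℂ (Set.range f)).topologicalClosure := by
  let g : ℕ ⊕ ℕ → A := Sum.elim f fun n => star (f n)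
  let L : (ℕ → FreeAlgebra ℂ (ℕ ⊕ ℕ)) → A := fun x =>
    Filter.limUnder Filter.atTop fun n => FreeAlgebra.lift ℂ g (x n)
  have hr : (StarAlgebra.adjoin ℂ (Set.range f) : Set A) = Set.range (FreeAlgebra.lift ℂ g) := by
    have h1 : Set.range f ∪ star (Set.range f) = Set.range g := by
      rw [Set.Sum.elim_range]
      congr 1
      ext x
      simp [Set.mem_star, eq_star_iff_eq_star, eq_comm]
    rw [← AlgHom.coe_range, ← Algebra.adjoin_range_eq_range_freeAlgebra_lift, ← h1]
    rfl
  refine small_subset (s := Set.range L) (t :=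
    ((StarAlgebra.adjoin ℂ (Set.range f)).topologicalClosure : Set A)) ?_
  intro a ha
  rw [StarSubalgebra.topologicalClosure_coe, mem_closure_iff_seq_limit] at ha
  obtain ⟨y, hy, hlim⟩ := ha
  rw [hr] at hy
  choose x hx using hy
  refine ⟨x, ?_⟩
  have hxy : (fun n => FreeAlgebra.lift ℂ g (x n)) = y := funext hx
  rw [← hxy] at hlim
  exact hlim.limUnder_eq

/-- The universal property of `O_θ`. -/
theorem existsUnique_lift {A : Type v} [CStarAlgebra A] (S : Λ →* A) (hS : G.IsCuntzType S) :
    ∃! φ : G.Alg →⋆ₐ[ℂ] A, ∀ w, φ (G.s w) = S w := by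
  refine existsUnique_of_exists_of_unique ?_ fun φ ψ hφ hψ =>
    G.hom_ext fun w => (hφ w).trans (hψ w).symm
  rcases subsingleton_or_nontrivial A with hA | hA
  · exact ⟨{ toFun := fun _ => 0, map_one' := Subsingleton.elim _ _,
             map_mul' := fun _ _ => Subsingleton.elim _ _, map_zero' := rfl,
             map_add' := fun _ _ => Subsingleton.elim _ _,
             commutes' := fun _ => Subsingleton.elim _ _,
             map_star' := fun _ => Subsingleton.elim _ _ }, fun _ => Subsingleton.elim _ _⟩
  have := G.countable_monoid
  obtain ⟨q, hq⟩ := exists_surjective_nat Λ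
  let C : StarSubalgebra ℂ A :=
    (StarAlgebra.adjoin ℂ (Set.range fun n => S (q n))).topologicalClosure
  have : IsClosed (C : Set A) := StarSubalgebra.isClosed_topologicalClosure _
  have : Small.{0} C := small_closure_adjoin _
  obtain ⟨B, hB, ⟨e⟩⟩ := exists_cstarAlgebra_equiv C
  have hmem : ∀ w, S w ∈ C := fun w => by
    obtain ⟨n, rfl⟩ := hq w
    exact StarSubalgebra.le_topologicalClosure _ (StarAlgebra.subset_adjoin ℂ _ ⟨n, rfl⟩)
  let ι : B →⋆ₐ[ℂ] A := C.subtype.comp (e : B →⋆ₐ[ℂ] C)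
  have hι : Function.Injective ι := Subtype.val_injective.comp e.injective
  let T : Λ →* B :=
    { toFun := fun w => e.symm ⟨S w, hmem w⟩
      map_one' := hι (by simp [ι])
      map_mul' := fun u v => hι (by simp [ι]) }
  have hT : ∀ w, ι (T w) = S w := fun w => by simp [ι, T]
  have hst : ∀ x, ι (star x) = star (ι x) := map_star ι
  have : Nontrivial B := ι.toRingHom.domain_nontrivial
  have hcT : G.IsCuntzType T :=
    { star_mul_self := fun i x => hι (by simpa [hT, hst] using hS.star_mul_self i x)
      star_mul_of_ne := fun i x y h => hι (by simpa [hT, hst] using hS.star_mul_of_ne i x y h)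
      sum_mul_star := fun i => hι (by simpa [hT, hst] using hS.sum_mul_star i) }
  exact ⟨ι.comp (G.evalRep ⟨B, T, hcT⟩), fun w => hT w⟩

/-- The unimodular number `t^{d(w)} = ∏ i, t_i ^ d(w)_i`, for `t` in the torus `𝕋^k`. -/
noncomputable def character (t : Fin k → Circle) : Λ →* Circle where
  toFun w := ∏ i, t i ^ G.d w i
  map_one' := by simp [G.d_one]
  map_mul' u v := by simp [G.d_mul, pow_add, Finset.prod_mul_distrib]

lemma character_inv (t : Fin k → Circle) (w : Λ) :
    G.character t⁻¹ w * G.character t w = 1 := by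
  simp [character]

lemma character_mul (t t' : Fin k → Circle) (w : Λ) :
    G.character (t * t') w = G.character t w * G.character t' w := by
  simp [character, mul_pow, Finset.prod_mul_distrib]

/-- The representation `w ↦ t^{d(w)} S_w`. -/
noncomputable def twist (t : Fin k → Circle) {A : Type v} [Ring A] [Algebra ℂ A] (S : Λ →* A) :
    Λ →* A where
  toFun w := (G.character t w : ℂ) • S w
  map_one' := by simp
  map_mul' u v := by simp [mul_smul_mul_comm]

lemma IsCuntzType.twist {G : SingleVertexKGraph k Λ} (t : Fin k → Circle) {A : Type v}
    [CStarAlgebra A] {S : Λ →* A} (hS : G.IsCuntzType S) : G.IsCuntzType (G.twist t S) := by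
  have hc : ∀ z : Circle, star (z : ℂ) * (z : ℂ) = 1 := fun z => by
    change (starRingEnd ℂ) (z : ℂ) * (z : ℂ) = 1
    rw [← Complex.normSq_eq_conj_mul_self]
    simp
  constructor
  · intro i e
    change star ((G.character t e : ℂ) • S e) * ((G.character t e : ℂ) • S e) = 1
    rw [star_smul, smul_mul_smul_comm, hc, hS.star_mul_self, one_smul]
  · intro i e f h
    change star ((G.character t e : ℂ) • S e) * ((G.character t f : ℂ) • S f) = 0
    rw [star_smul, smul_mul_smul_comm, hS.star_mul_of_ne i e f h, smul_zero]
  · intro i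
    rw [← hS.sum_mul_star i]
    refine Finset.sum_congr rfl fun e _ => ?_
    change ((G.character t e : ℂ) • S e) * star ((G.character t e : ℂ) • S e) = _
    rw [star_smul, smul_mul_smul_comm, mul_comm, hc, one_smul]

/-- The gauge endomorphism `s_w ↦ t^{d(w)} s_w`. -/
noncomputable def gaugeHom (t : Fin k → Circle) : G.Alg →⋆ₐ[ℂ] G.Alg :=
  (G.existsUnique_lift (G.twist t G.s) (G.s_isCuntzType.twist t)).choose

lemma gaugeHom_s (t : Fin k → Circle) (w : Λ) :
    G.gaugeHom t (G.s w) = (G.character t w : ℂ) • G.s w :=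
  (G.existsUnique_lift (G.twist t G.s) (G.s_isCuntzType.twist t)).choose_spec.1 w

lemma gaugeHom_comp (t t' : Fin k → Circle) :
    (G.gaugeHom t).comp (G.gaugeHom t') = G.gaugeHom (t * t') := by
  refine G.hom_ext fun w => ?_
  rw [StarAlgHom.comp_apply, gaugeHom_s, map_smul, gaugeHom_s, gaugeHom_s, smul_smul,
    character_mul, Circle.coe_mul, mul_comm]

lemma gaugeHom_one : G.gaugeHom 1 = StarAlgHom.id ℂ G.Alg := by
  refine G.hom_ext fun w => ?_
  simp [gaugeHom_s, character]

/-- The gauge automorphism `γ_t`, `t ∈ 𝕋^k`, of `O_θ`, given by `γ_t(s_w) = t^{d(w)} s_w`. -/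
noncomputable def gauge (t : Fin k → Circle) : G.Alg ≃⋆ₐ[ℂ] G.Alg :=
  StarAlgEquiv.ofStarAlgHom (G.gaugeHom t) (G.gaugeHom t⁻¹)
    (by rw [gaugeHom_comp, inv_mul_cancel, gaugeHom_one])
    (by rw [gaugeHom_comp, mul_inv_cancel, gaugeHom_one])

lemma gauge_s (t : Fin k → Circle) (w : Λ) :
    G.gauge t (G.s w) = (G.character t w : ℂ) • G.s w := G.gaugeHom_s t w

lemma gauge_gauge (t t' : Fin k → Circle) (a : G.Alg) :
    G.gauge t (G.gauge t' a) = G.gauge (t * t') a :=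
  DFunLike.congr_fun (G.gaugeHom_comp t t') a

/-- The fixed point algebra of a family of automorphisms. -/
def fixedPoints {ι : Type*} {A : Type v} [CStarAlgebra A] (α : ι → (A ≃⋆ₐ[ℂ] A)) :
    StarSubalgebra ℂ A where
  carrier := {a | ∀ t, α t a = a}
  mul_mem' ha hb t := by rw [map_mul, ha t, hb t]
  one_mem' t := map_one _
  add_mem' ha hb t := by rw [map_add, ha t, hb t]
  zero_mem' t := map_zero _
  algebraMap_mem' r t := by
    rw [Algebra.algebraMap_eq_smul_one, map_smul, map_one]
  star_mem' ha t := by rw [map_star, ha t]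

/-- The core `𝔉`: the fixed point algebra of the gauge action. -/
noncomputable def core : StarSubalgebra ℂ G.Alg := fixedPoints G.gauge

/-- `Φ₀(a) = ∫_{𝕋^k} γ_t(a) dt`, with respect to normalized Haar measure; `𝕋^k` is parametrized
by `(ℝ/ℤ)^k`. -/
noncomputable def expectation (a : G.Alg) : G.Alg :=
  ∫ x : UnitAddTorus (Fin k), G.gauge (fun i => (x i).toCircle) a
    ∂(MeasureTheory.Measure.pi fun _ => AddCircle.haarAddCircle)

lemma expectation_mem_core (a : G.Alg) : G.expectation a ∈ G.core := by
  intro t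
  have h : ∀ i, ∃ y : UnitAddCircle, y.toCircle = t i := fun i => by
    obtain ⟨y, hy⟩ := (AddCircle.homeomorphCircle one_ne_zero).surjective (t i)
    exact ⟨y, by rw [← hy, AddCircle.homeomorphCircle_apply]⟩
  choose y hy using h
  have hiso : Isometry (G.gauge t) := NonUnitalStarAlgHom.isometry _ (G.gauge t).injective
  let L : G.Alg ≃ₗᵢ[ℂ] G.Alg :=
    { toFun := G.gauge t
      invFun := (G.gauge t).symm
      left_inv := (G.gauge t).left_inv
      right_inv := (G.gauge t).right_inv
      map_add' := map_add _
      map_smul' := map_smul _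
      norm_map' := fun x => hiso.norm_map_of_map_zero (map_zero _) x }
  have hL : ∀ b, L b = G.gauge t b := fun _ => rfl
  rw [← hL, expectation]
  have h1 := L.toContinuousLinearEquiv.integral_comp_comm
    (μ := MeasureTheory.Measure.pi fun _ : Fin k => AddCircle.haarAddCircle (T := 1))
    (fun x : UnitAddTorus (Fin k) => G.gauge (fun i => (x i).toCircle) a)
  refine Eq.trans h1.symm ?_
  have h2 : ∀ x : UnitAddTorus (Fin k),
      L.toContinuousLinearEquiv (G.gauge (fun i => (x i).toCircle) a) =
        (fun z : UnitAddTorus (Fin k) => G.gauge (fun i => (z i).toCircle) a) (y + x) := by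
    intro x
    refine (G.gauge_gauge t _ a).trans ?_
    have : (t * fun i => (x i).toCircle) = fun i => ((y + x) i).toCircle := by
      funext i
      rw [Pi.mul_apply, Pi.add_apply, AddCircle.toCircle_add, hy]
    rw [this]
  simp_rw [h2]
  exact MeasureTheory.integral_add_left_eq_self
    (μ := MeasureTheory.Measure.pi fun _ : Fin k => AddCircle.haarAddCircle (T := 1))
    (fun z : UnitAddTorus (Fin k) => G.gauge (fun i => (z i).toCircle) a) y

/-- A tracial state: a positive unital linear functional with `φ(ab) = φ(ba)`. -/
structure IsTracialState {A : Type v} [Ring A] [StarRing A] [Algebra ℂ A] (φ : A →ₗ[ℂ] ℂ) :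
    Prop where
  map_one : φ 1 = 1
  re_nonneg : ∀ a, 0 ≤ (φ (star a * a)).re
  im_eq_zero : ∀ a, (φ (star a * a)).im = 0
  tracial : ∀ a b, φ (a * b) = φ (b * a)

/-- The functional `ω = τ ∘ Φ₀` on `O_θ`. -/
noncomputable def omega (τ : G.core →ₗ[ℂ] ℂ) (a : G.Alg) : ℂ :=
  τ ⟨G.expectation a, G.expectation_mem_core a⟩

/-- The flow `σ` on `O_θ` with
`σ_t(s_u s_v^*) = m^{it(d(v) - d(u))} s_u s_v^*`, i.e. `σ_t = γ_{(m_1^{-it}, …, m_k^{-it})}`. -/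
noncomputable def modularFlow (t : ℝ) : G.Alg ≃⋆ₐ[ℂ] G.Alg :=
  G.gauge fun i => Circle.exp (-(t * Real.log (G.m i)))

/-- `σ` is the modular automorphism group of the functional `ω`: a strongly continuous
one-parameter group of automorphisms that preserves `ω` and satisfies the modular (KMS) condition:
for all `a`, `b` there is a bounded continuous function `F` on the strip `0 ≤ Im z ≤ 1`, analytic
in its interior, with `F(t) = ω(σ_t(a) b)` and `F(t + i) = ω(b σ_t(a))` for all real `t`. -/
structure IsModularGroup {A : Type v} [CStarAlgebra A] (ω : A → ℂ) (σ : ℝ → (A ≃⋆ₐ[ℂ] A)) :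
    Prop where
  map_zero : ∀ a, σ 0 a = a
  map_add : ∀ t u a, σ (t + u) a = σ t (σ u a)
  continuous : ∀ a, Continuous fun t => σ t a
  invariant : ∀ t a, ω (σ t a) = ω a
  kms : ∀ a b, ∃ F : ℂ → ℂ, DiffContOnCl ℂ F {z | 0 < z.im ∧ z.im < 1} ∧
    (∃ C : ℝ, ∀ z : ℂ, 0 ≤ z.im → z.im ≤ 1 → ‖F z‖ ≤ C) ∧
    ∀ t : ℝ, F t = ω (σ t a * b) ∧ F (t + Complex.I) = ω (b * σ t a)

/-- The fixed point algebra `O_θ^σ` of the modular action. -/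
noncomputable def modularFixed : StarSubalgebra ℂ G.Alg := fixedPoints G.modularFlow

lemma core_le_modularFixed : G.core ≤ G.modularFixed := fun _ ha _ => ha _

end SingleVertexKGraph

/-! The monomials `s_u s_v^*` span a dense subspace of the algebra, so everything is decided by
scalars on monomials.

Existence. A representation on an `ℓ²` space shows that the algebra is nonzero and has a state `ψ`.
Averaging `ψ(s_w^* a s_w)` over the words `w` of degree `p` gives a state that commutes with every
`s_u s_v^*` with `d(u) = d(v) = p`; since `s_u s_v^* = ∑ s_{uw} s_{vw}^*`, a limit over `p = (n, …,
n)` commutes with all degree-zero monomials (`exists_central_state`). Its restriction to the core is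
`τ`, and `ω = τ ∘ Φ₀` takes the value `δ_{u,v} m^{-d(u)}` on `s_u s_v^*`. These values give `ω(s_u
s_v^* b) = m^{d(v)-d(u)} ω(b s_u s_v^*)` (`IsGaugeTrace.mono_mul`). This is the KMS condition on
monomials, and it extends to the algebra by the three lines theorem. It also says that `ω` is
tracial on the fixed points of `σ`, so the required trace is the restriction of `ω`.

Uniqueness. A fixed point algebra is the closed span of its fixed monomials
(`mem_closure_span_fixed`), and tracial states are contractive, so only their values on monomials
matter. For `d(u) = d(v)` matrix units force the value `δ_{u,v} m^{-d(u)}`. Under (b) no other fixed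
monomials exist. Under (a), let `m^{d(u)} = m^{d(v)}` with `d(u) ≠ d(v)`. After removing the
prefixes of degree `d(u) ∧ d(v)` one may take `u` and `v` without a common colour. Then a trace `φ`
satisfies `φ(x) = m^{-p} ∑_w φ_w(s_w^* x s_w)` with tracial states `φ_w`, the sum being over the
words of degree `p`. For `x = s_u s_v^*` and `p = (n+1) d(u)`, a nonzero term requires `w = uα` with
`uα` and `vα` having a common extension; the little pull-back property leaves at most one such `α`
(`LittlePullback.eq_of_common_extension`). Hence `|φ(x)| ≤ m^{-(n+1) d(u)}`, which tends to zero. -/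

namespace SingleVertexKGraph

variable {k : ℕ} {Λ : Type u} [Monoid Λ] (G : SingleVertexKGraph k Λ)

/-! ### Cancellation, factorization and counting of words. -/

section Combinatorics

lemma eq_and_eq_of_mul_eq_mul {a b a' b' : Λ} (h : a * b = a' * b') (hd : G.d a = G.d a') :
    a = a' ∧ b = b' := by
  have hb : G.d b = G.d b' := by
    have := congrArg G.d h
    rw [G.d_mul, G.d_mul, hd] at this
    exact add_left_cancel this
  have := (G.factorization (a * b) _ _ (G.d_mul a b)).unique (y₁ := (a, b)) (y₂ := (a', b'))
    ⟨rfl, rfl, rfl⟩ ⟨h, hd.symm, hb.symm⟩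
  exact Prod.mk.inj this

lemma mul_left_cancel' (G : SingleVertexKGraph k Λ) {a b b' : Λ} (h : a * b = a * b') : b = b' :=
  (G.eq_and_eq_of_mul_eq_mul h rfl).2

lemma mul_right_cancel' (G : SingleVertexKGraph k Λ) {a a' b : Λ} (h : a * b = a' * b) : a = a' := by
  refine (G.eq_and_eq_of_mul_eq_mul h ?_).1
  have := congrArg G.d h
  rw [G.d_mul, G.d_mul] at this
  exact add_right_cancel this

lemma exists_factor {w : Λ} {p : Fin k → ℕ} (h : p ≤ G.d w) :
    ∃ a b, w = a * b ∧ G.d a = p ∧ G.d b = G.d w - p := by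
  obtain ⟨x, hx, -⟩ := G.factorization w p (G.d w - p) (add_tsub_cancel_of_le h).symm
  exact ⟨x.1, x.2, hx⟩

/-- The words of degree `p`. -/
abbrev Word (p : Fin k → ℕ) : Type u := {w : Λ // G.d w = p}

/-- Factorization of words of degree `p + q`. -/
noncomputable def wordMul (p q : Fin k → ℕ) : G.Word p × G.Word q ≃ G.Word (p + q) :=
  Equiv.ofBijective (fun x => ⟨x.1 * x.2, by rw [G.d_mul, x.1.2, x.2.2]⟩) <| by
    constructor
    · rintro ⟨⟨a, ha⟩, ⟨b, hb⟩⟩ ⟨⟨a', ha'⟩, ⟨b', hb'⟩⟩ h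
      obtain ⟨rfl, rfl⟩ := G.eq_and_eq_of_mul_eq_mul (Subtype.ext_iff.1 h) (ha.trans ha'.symm)
      rfl
    · rintro ⟨w, hw⟩
      obtain ⟨a, b, h, ha, hb⟩ := G.exists_factor (w := w) (p := p) (by simp [hw])
      exact ⟨(⟨a, ha⟩, ⟨b, by simp [hb, hw]⟩), Subtype.ext h.symm⟩

@[simp] lemma wordMul_coe (p q : Fin k → ℕ) (x : G.Word p × G.Word q) :
    (G.wordMul p q x : Λ) = x.1 * x.2 := rfl

lemma degree_induction {P : (Fin k → ℕ) → Prop} (h0 : P 0)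
    (h : ∀ i p, P p → P (Pi.single i 1 + p)) (p : Fin k → ℕ) : P p := by
  induction hn : ∑ i, p i using Nat.strong_induction_on generalizing p with
  | _ n ih =>
    by_cases hp : p = 0
    · rw [hp]; exact h0
    obtain ⟨i, hi⟩ := Function.ne_iff.1 hp
    have hle : Pi.single i 1 ≤ p := by
      intro j
      by_cases hj : j = i
      · subst hj
        simpa [Nat.one_le_iff_ne_zero] using hi
      · simp [hj]
    rw [← add_tsub_cancel_of_le hle]
    refine h i _ (ih _ ?_ _ rfl)
    rw [← hn]
    refine Finset.sum_lt_sum (fun j _ => by simp) ⟨i, Finset.mem_univ i, ?_⟩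
    have : 0 < p i := Nat.pos_of_ne_zero hi
    simpa using this

instance finite_word (p : Fin k → ℕ) : Finite (G.Word p) := by
  induction p using degree_induction with
  | h0 =>
    have : Subsingleton (G.Word 0) :=
      ⟨fun a b => Subtype.ext ((G.eq_one_of_d_eq_zero a.2).trans (G.eq_one_of_d_eq_zero b.2).symm)⟩
    infer_instance
  | h i p ih =>
    have := G.finite_edges i
    exact Finite.of_equiv _ (G.wordMul (Pi.single i 1) p)

noncomputable instance fintypeWord (p : Fin k → ℕ) : Fintype (G.Word p) := Fintype.ofFinite _

/-- The product `m^p`. -/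
noncomputable def weight (p : Fin k → ℕ) : ℝ := ∏ i, (G.m i : ℝ) ^ p i

@[simp] lemma weight_zero : G.weight 0 = 1 := by simp [weight]

lemma weight_add (p q : Fin k → ℕ) : G.weight (p + q) = G.weight p * G.weight q := by
  simp [weight, pow_add, Finset.prod_mul_distrib]

@[simp] lemma weight_single (i : Fin k) : G.weight (Pi.single i 1) = G.m i := by
  rw [weight, Finset.prod_eq_single i]
  · simp
  · intro j _ hj; simp [hj]
  · simp

lemma weight_nsmul (n : ℕ) (p : Fin k → ℕ) : G.weight (n • p) = G.weight p ^ n := by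
  induction n with
  | zero => simp
  | succ n ih => rw [succ_nsmul, weight_add, ih, pow_succ]

lemma card_word (p : Fin k → ℕ) : (Fintype.card (G.Word p) : ℝ) = G.weight p := by
  induction p using degree_induction with
  | h0 =>
    have : Unique (G.Word 0) :=
      ⟨⟨⟨1, G.d_one⟩⟩, fun a => Subtype.ext (G.eq_one_of_d_eq_zero a.2)⟩
    rw [weight_zero, Fintype.card_unique, Nat.cast_one]
  | h i p ih =>
    rw [← Fintype.card_congr (G.wordMul (Pi.single i 1) p), Fintype.card_prod, Nat.cast_mul, ih,
      weight_add, weight_single]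
    congr 2

variable {G}

lemma weight_pos (hm : ∀ i, 1 < G.m i) (p : Fin k → ℕ) : 0 < G.weight p :=
  Finset.prod_pos fun i _ => pow_pos (by exact_mod_cast zero_lt_one.trans (hm i)) _

lemma one_lt_weight (hm : ∀ i, 1 < G.m i) {p : Fin k → ℕ} (hp : p ≠ 0) : 1 < G.weight p := by
  obtain ⟨i, hi⟩ := Function.ne_iff.1 hp
  have hle : Pi.single i 1 ≤ p := by
    intro j
    by_cases hj : j = i
    · subst hj
      simpa [Nat.one_le_iff_ne_zero] using hi
    · simp [hj]
  rw [← add_tsub_cancel_of_le hle, weight_add, weight_single]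
  have h1 : (1 : ℝ) < G.m i := by exact_mod_cast hm i
  have h2 : 1 ≤ G.weight (p - Pi.single i 1) := by
    refine Finset.one_le_prod fun j _ => one_le_pow₀ ?_
    exact_mod_cast (hm j).le
  nlinarith

end Combinatorics

/-! ### Relations between words in a Cuntz-type representation. -/

namespace IsCuntzType

variable {G} {A : Type v} [Ring A] [StarRing A] {S : Λ →* A}

lemma star_mul_of_ne_word (hS : G.IsCuntzType S) {a b : Λ} (hd : G.d a = G.d b) (hne : a ≠ b) :
    star (S a) * S b = 0 := by
  induction a using G.edge_induction generalizing b with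
  | h1 => exact absurd (G.eq_one_of_d_eq_zero (by rw [← hd, G.d_one])).symm hne
  | hmul i e w ih =>
    obtain ⟨f, b', rfl, hf, hb'⟩ := G.exists_factor (w := b) (p := Pi.single i 1)
      (by rw [← hd, G.d_mul, e.2]; simp)
    rw [map_mul, star_mul, map_mul, mul_assoc, ← mul_assoc (star (S e))]
    by_cases hef : (e : Λ) = f
    · subst hef
      rw [hS.star_mul_self, one_mul]
      refine ih ?_ fun h => hne (by rw [h])
      rw [G.d_mul, G.d_mul] at hd
      exact add_left_cancel hd
    · rw [hS.star_mul_of_ne i e ⟨f, hf⟩ fun h => hef (congrArg Subtype.val h), zero_mul, mul_zero]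

lemma sum_word (hS : G.IsCuntzType S) (p : Fin k → ℕ) :
    ∑ w : G.Word p, S w * star (S w) = 1 := by
  induction p using degree_induction with
  | h0 =>
    have : Unique (G.Word 0) :=
      ⟨⟨⟨1, G.d_one⟩⟩, fun a => Subtype.ext (G.eq_one_of_d_eq_zero a.2)⟩
    rw [Fintype.sum_unique, G.eq_one_of_d_eq_zero (default : G.Word 0).2]
    simp
  | h i p ih =>
    rw [← (G.wordMul (Pi.single i 1) p).sum_comp, Fintype.sum_prod_type]
    have h1 := hS.sum_mul_star i
    have : ∀ e : G.Word (Pi.single i 1), ∑ w : G.Word p,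
        S (G.wordMul (Pi.single i 1) p (e, w)) * star (S (G.wordMul (Pi.single i 1) p (e, w))) =
        S e * star (S e) := by
      intro e
      calc _ = ∑ w : G.Word p, S e * (S w * star (S w)) * star (S e) := by
            refine Finset.sum_congr rfl fun w _ => ?_
            simp [mul_assoc]
        _ = _ := by rw [← Finset.sum_mul, ← Finset.mul_sum, ih, mul_one]
    rw [Finset.sum_congr rfl fun e _ => this e, ← h1]

lemma star_mul_mul (hS : G.IsCuntzType S) (a b : Λ) : star (S a) * S (a * b) = S b := by
  rw [map_mul, ← mul_assoc, hS.isometry, one_mul]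

lemma star_mul_mul' (hS : G.IsCuntzType S) (a b : Λ) : star (S (a * b)) * S a = star (S b) := by
  rw [map_mul, star_mul, mul_assoc, hS.isometry, mul_one]

/-- Insert `1 = ∑ S_y S_y^*` over the words `y` of degree `d(b)`. In a nonzero term the prefix of `a
y` of degree `d(b)` cannot be orthogonal to `b`, so it equals `b`. -/
lemma exists_common_extension (hS : G.IsCuntzType S) {a b : Λ} (h : star (S a) * S b ≠ 0) :
    ∃ y z, a * y = b * z := by
  have h1 : star (S a) * S b =
      ∑ y : G.Word (G.d b), S y * (star (S (a * y)) * S b) := by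
    rw [← one_mul (star (S a) * S b), ← hS.sum_word (G.d b), Finset.sum_mul]
    refine Finset.sum_congr rfl fun y _ => ?_
    rw [map_mul, star_mul]
    simp only [mul_assoc]
  rw [h1] at h
  obtain ⟨y, -, hy⟩ := Finset.exists_ne_zero_of_sum_ne_zero h
  obtain ⟨b', z, hbz, hb', -⟩ := G.exists_factor (w := a * (y : Λ)) (p := G.d b)
    (by rw [G.d_mul, y.2]; simp)
  by_cases hbb : b' = b
  · exact ⟨y, z, hbb ▸ hbz⟩
  · rw [hbz, map_mul, star_mul, mul_assoc, hS.star_mul_of_ne_word hb' hbb, mul_zero,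
      mul_zero] at hy
    exact absurd rfl hy

end IsCuntzType

/-! ### Density of the span of the monomials. -/

section Monomials

/-- The monomial `s_u s_v^*`. -/
noncomputable def mono (u v : Λ) : G.Alg := G.s u * star (G.s v)

lemma mono_one_one : G.mono 1 1 = 1 := by simp [mono]

lemma s_mul_mono (w u v : Λ) : G.s w * G.mono u v = G.mono (w * u) v := by
  simp [mono, mul_assoc]

lemma mono_mul_star_s (w u v : Λ) : G.mono u v * star (G.s w) = G.mono u (w * v) := by
  simp [mono, mul_assoc]

lemma norm_s_le (w : Λ) : ‖G.s w‖ ≤ 1 := by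
  rcases subsingleton_or_nontrivial G.Alg with h | h
  · rw [Subsingleton.elim (G.s w) 0, norm_zero]; exact zero_le_one
  have h : ‖G.s w‖ * ‖G.s w‖ = 1 := by
    rw [← CStarRing.norm_star_mul_self, G.s_isCuntzType.isometry, CStarRing.norm_one]
  nlinarith [norm_nonneg (G.s w)]

lemma mono_mul_mono (u v w : Λ) : G.mono u v * G.mono v w = G.mono u w := by
  rw [mono, mono, mul_assoc, ← mul_assoc (star (G.s v)), G.s_isCuntzType.isometry, one_mul, mono]

lemma mono_mul_mono_of_ne {u v v' w : Λ} (hd : G.d v = G.d v') (h : v ≠ v') :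
    G.mono u v * G.mono v' w = 0 := by
  rw [mono, mono, mul_assoc, ← mul_assoc (star (G.s v)),
    G.s_isCuntzType.star_mul_of_ne_word hd h, zero_mul, mul_zero]

lemma sum_mono (p : Fin k → ℕ) : ∑ w : G.Word p, G.mono w w = 1 := G.s_isCuntzType.sum_word p

lemma mono_eq_sum (u v : Λ) (p : Fin k → ℕ) :
    G.mono u v = ∑ w : G.Word p, G.mono (u * w) (v * w) := by
  calc G.mono u v = G.s u * 1 * star (G.s v) := by rw [mul_one, mono]
    _ = _ := by
      rw [← G.sum_mono p, Finset.mul_sum, Finset.sum_mul]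
      simp [mono, mul_assoc]

/-- Lengthening both words by an edge of colour `i` lets the second word be refactored to begin with
that colour, after which its first edge either cancels `e` or is orthogonal to it. -/
lemma mono_mul_s_mem_span (u v : Λ) (i : Fin k) (e : G.Edge i) :
    G.mono u v * G.s e ∈ Submodule.span ℂ (Set.range fun x : Λ × Λ => G.mono x.1 x.2) := by
  rw [G.mono_eq_sum u v (Pi.single i 1), Finset.sum_mul]
  refine Submodule.sum_mem _ fun g _ => ?_
  obtain ⟨f, y, hfy, hf, -⟩ := G.exists_factor (w := v * (g : Λ)) (p := Pi.single i 1)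
    (by rw [G.d_mul, g.2]; simp)
  rw [hfy]
  by_cases h : f = e
  · subst h
    rw [mono, mul_assoc, G.s_isCuntzType.star_mul_mul']
    exact Submodule.subset_span ⟨(u * g, y), rfl⟩
  · rw [mono, map_mul G.s f, star_mul, mul_assoc, mul_assoc,
      G.s_isCuntzType.star_mul_of_ne_word (hf.trans e.2.symm) h, mul_zero, mul_zero]
    exact Submodule.zero_mem _

/-- The universal property maps the algebra into the closed subalgebra `D` generated by the `s_w`;
followed by the inclusion this map fixes the generators, so it is the identity and every element
lies in `D`. -/
lemma adjoin_closure_eq_top :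
    (StarAlgebra.adjoin ℂ (Set.range G.s)).topologicalClosure = ⊤ := by
  set D := (StarAlgebra.adjoin ℂ (Set.range G.s)).topologicalClosure with hD
  have : IsClosed (D : Set G.Alg) := StarSubalgebra.isClosed_topologicalClosure _
  have hmem : ∀ w, G.s w ∈ D := fun w =>
    StarSubalgebra.le_topologicalClosure _ (StarAlgebra.subset_adjoin ℂ _ ⟨w, rfl⟩)
  let S : Λ →* D :=
    { toFun := fun w => ⟨G.s w, hmem w⟩
      map_one' := Subtype.ext (map_one G.s)
      map_mul' := fun u v => Subtype.ext (map_mul G.s u v) }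
  have hS : G.IsCuntzType S :=
    { star_mul_self := fun i e => Subtype.ext (G.s_isCuntzType.star_mul_self i e)
      star_mul_of_ne := fun i e f h => Subtype.ext (G.s_isCuntzType.star_mul_of_ne i e f h)
      sum_mul_star := fun i => Subtype.ext <| by
        rw [AddSubmonoidClass.coe_finsetSum]
        exact G.s_isCuntzType.sum_mul_star i }
  obtain ⟨φ, hφ, -⟩ := G.existsUnique_lift S hS
  have h : D.subtype.comp φ = StarAlgHom.id ℂ G.Alg :=
    G.hom_ext fun w => congrArg Subtype.val (hφ w)
  rw [eq_top_iff]
  intro a _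
  have := DFunLike.congr_fun h a
  exact (show D.subtype (φ a) = a from this) ▸ (φ a).2

lemma adjoin_le_span (a : G.Alg) (ha : a ∈ StarAlgebra.adjoin ℂ (Set.range G.s)) :
    a ∈ Submodule.span ℂ (Set.range fun x : Λ × Λ => G.mono x.1 x.2) := by
  set V := Submodule.span ℂ (Set.range fun x : Λ × Λ => G.mono x.1 x.2) with hV
  have hmul : ∀ b, (∀ u v, G.mono u v * b ∈ V) → ∀ x ∈ V, x * b ∈ V := by
    intro b hb x hx
    induction hx using Submodule.span_induction with
    | mem x hx => obtain ⟨y, rfl⟩ := hx; exact hb _ _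
    | zero => simp
    | add x y _ _ h1 h2 => rw [add_mul]; exact V.add_mem h1 h2
    | smul c x _ h => rw [smul_mul_assoc]; exact V.smul_mem c h
  have hs : ∀ w : Λ, ∀ x ∈ V, x * G.s w ∈ V := by
    intro w
    induction w using G.edge_induction with
    | h1 => simp
    | hmul i e w ih =>
      intro x hx
      rw [map_mul, ← mul_assoc]
      exact ih _ (hmul _ (fun u v => G.mono_mul_s_mem_span u v i e) x hx)
  -- It is enough that right multiplication by generators and their adjoints preserves `V`, because
  -- `V` contains `1`.
  have key : ∀ x ∈ V, x * a ∈ V := by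
    change a ∈ Algebra.adjoin ℂ _ at ha
    induction ha using Algebra.adjoin_induction with
    | mem y hy =>
      rcases hy with ⟨w, rfl⟩ | hy
      · exact hs w
      · obtain ⟨w, hw⟩ := hy
        obtain rfl : y = star (G.s w) := by rw [hw, star_star]
        refine hmul _ fun u v => ?_
        rw [mono_mul_star_s]
        exact Submodule.subset_span ⟨(u, w * v), rfl⟩
    | algebraMap r =>
      intro x hx
      rw [Algebra.algebraMap_eq_smul_one, mul_smul_comm, mul_one]
      exact V.smul_mem r hx
    | add y z _ _ h1 h2 => intro x hx; rw [mul_add]; exact V.add_mem (h1 x hx) (h2 x hx)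
    | mul y z _ _ h1 h2 => intro x hx; rw [← mul_assoc]; exact h2 _ (h1 x hx)
  have := key 1 (Submodule.subset_span ⟨(1, 1), G.mono_one_one⟩)
  rwa [one_mul] at this

lemma dense_span_mono :
    Dense (Submodule.span ℂ (Set.range fun x : Λ × Λ => G.mono x.1 x.2) : Set G.Alg) := by
  have h : Dense (StarAlgebra.adjoin ℂ (Set.range G.s) : Set G.Alg) := by
    rw [dense_iff_closure_eq, ← StarSubalgebra.topologicalClosure_coe, adjoin_closure_eq_top]
    rfl
  exact h.mono G.adjoin_le_span

/-- Continuous linear maps which agree on the monomials are equal. -/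
lemma clm_ext {E : Type*} [NormedAddCommGroup E] [NormedSpace ℂ E] {f g : G.Alg →L[ℂ] E}
    (h : ∀ u v, f (G.mono u v) = g (G.mono u v)) : f = g :=
  ContinuousLinearMap.ext_on G.dense_span_mono <| by
    rintro _ ⟨x, rfl⟩
    exact h _ _

end Monomials

/-! ### A Cuntz-type representation on a nonzero Hilbert space. -/

section Representation

lemma exists_degree_ge_one (hm : ∀ i, 1 < G.m i) : ∃ c : Λ, ∀ i, Pi.single i 1 ≤ G.d c := by
  have h : ∀ p : Fin k → ℕ, ∃ c : Λ, G.d c = p := fun p => by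
    have h1 := G.weight_pos hm p
    rw [← card_word] at h1
    have : 0 < Fintype.card (G.Word p) := by exact_mod_cast h1
    obtain ⟨c⟩ := Fintype.card_pos_iff.1 this
    exact ⟨c, c.2⟩
  obtain ⟨c, hc⟩ := h 1
  refine ⟨c, fun i j => ?_⟩
  rw [hc]
  by_cases hj : j = i
  · subst hj; simp
  · simp [hj]

/-- The relation `u c^{-a} = v c^{-b}` on `Λ × ℕ`. -/
def tailSetoid (c : Λ) : Setoid (Λ × ℕ) where
  r x y := x.1 * c ^ y.2 = y.1 * c ^ x.2
  iseqv :=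
    { refl := fun _ => rfl
      symm := fun h => h.symm
      trans := by
        rintro ⟨u, a⟩ ⟨v, b⟩ ⟨w, g⟩ h1 h2
        dsimp only at h1 h2 ⊢
        refine G.mul_right_cancel' (b := c ^ b) ?_
        calc u * c ^ g * c ^ b = u * c ^ b * c ^ g := by
              rw [mul_assoc, mul_assoc, ← pow_add, ← pow_add, add_comm]
          _ = v * c ^ g * c ^ a := by
              rw [h1, mul_assoc, mul_assoc, ← pow_add, ← pow_add, add_comm]
          _ = w * c ^ a * c ^ b := by
              rw [h2, mul_assoc, mul_assoc, ← pow_add, ← pow_add, add_comm] }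

/-- The set on which `Λ` acts by the inductive limit of the right multiplications by `c`. -/
abbrev Tail (c : Λ) : Type u := Quotient (G.tailSetoid c)

/-- The left action of `Λ`. -/
def act (c w : Λ) : G.Tail c → G.Tail c :=
  Quotient.map' (s₁ := G.tailSetoid c) (s₂ := G.tailSetoid c) (fun x => (w * x.1, x.2)) <| by
    rintro ⟨u, a⟩ ⟨v, b⟩ h
    change w * u * c ^ b = w * v * c ^ a
    rw [mul_assoc, mul_assoc]
    exact congrArg (w * ·) h

lemma act_mk (c w : Λ) (x : Λ × ℕ) :
    G.act c w (Quotient.mk (G.tailSetoid c) x) = Quotient.mk (G.tailSetoid c) (w * x.1, x.2) := rfl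

lemma act_one (c : Λ) (x : G.Tail c) : G.act c 1 x = x := by
  induction x using Quotient.inductionOn with
  | _ x => rw [act_mk, one_mul]

lemma act_mul (c w w' : Λ) (x : G.Tail c) : G.act c (w * w') x = G.act c w (G.act c w' x) := by
  induction x using Quotient.inductionOn with
  | _ x => rw [act_mk, act_mk, act_mk, mul_assoc]

lemma act_eq_act {c w w' : Λ} (hd : G.d w = G.d w') {x y : G.Tail c}
    (h : G.act c w x = G.act c w' y) : w = w' ∧ x = y := by
  induction x using Quotient.inductionOn with
  | _ x =>
  induction y using Quotient.inductionOn with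
  | _ y =>
    have h1 : w * x.1 * c ^ y.2 = w' * y.1 * c ^ x.2 := Quotient.exact h
    rw [mul_assoc, mul_assoc] at h1
    obtain ⟨h2, h3⟩ := G.eq_and_eq_of_mul_eq_mul h1 hd
    exact ⟨h2, Quotient.sound h3⟩

/-- The class of `(y, n)` is also that of `(y c, n + 1)`, and `y c` begins with an edge of each
colour because `c` contains every colour. The limit along `c` is taken for this surjectivity, which
gives `∑ S_e S_e^* = 1`. -/
lemma exists_act_edge {c : Λ} (hc : ∀ i, Pi.single i 1 ≤ G.d c) (i : Fin k) (y : G.Tail c) :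
    ∃ (e : G.Edge i) (x : G.Tail c), G.act c e x = y := by
  induction y using Quotient.inductionOn with
  | _ y =>
    obtain ⟨e, b, h, he, -⟩ := G.exists_factor (w := y.1 * c) (p := Pi.single i 1)
      ((hc i).trans (by rw [G.d_mul]; simp))
    refine ⟨⟨e, he⟩, Quotient.mk _ (b, y.2 + 1), Quotient.sound ?_⟩
    change e * b * c ^ y.2 = y.1 * c ^ (y.2 + 1)
    rw [← h, mul_assoc, ← pow_succ']

/-- The Hilbert space `ℓ²(X)`. -/
abbrev L2 (c : Λ) : Type u := lp (fun _ : G.Tail c => ℂ) 2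

/-- The pull-back operator along the action of `w`. -/
noncomputable def pull (c w : Λ) : G.L2 c →L[ℂ] G.L2 c :=
  have hinj : Function.Injective (G.act c w) := fun _ _ h => (G.act_eq_act rfl h).2
  have hmem : ∀ g : G.L2 c, Memℓp (fun x => g (G.act c w x)) 2 := fun g => by
    have h := lp.memℓp g
    rw [memℓp_gen_iff (by norm_num)] at h ⊢
    exact h.comp_injective hinj
  LinearMap.mkContinuous
    { toFun := fun g => ⟨fun x => g (G.act c w x), hmem g⟩
      map_add' := fun _ _ => rfl
      map_smul' := fun _ _ => rfl } 1 <| by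
    intro g
    rw [one_mul]
    have h2 : (0 : ℝ) < (2 : ℝ≥0∞).toReal := by norm_num
    refine lp.norm_le_of_tsum_le h2 (norm_nonneg _) ?_
    rw [lp.norm_rpow_eq_tsum h2 g]
    have h := lp.memℓp g
    rw [memℓp_gen_iff h2] at h
    exact (h.comp_injective hinj).tsum_le_tsum_of_inj (G.act c w) hinj
      (fun _ _ => by positivity) (fun _ => le_rfl) h

@[simp] lemma pull_apply (c w : Λ) (g : G.L2 c) (x : G.Tail c) :
    G.pull c w g x = g (G.act c w x) := rfl

open Classical in
/-- The basis vectors of `ℓ²(X)`. -/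
noncomputable def basisVec (c : Λ) (x : G.Tail c) : G.L2 c := lp.single 2 x (1 : ℂ)

lemma inner_basisVec (c : Λ) (x : G.Tail c) (g : G.L2 c) : inner ℂ (G.basisVec c x) g = g x := by
  classical
  rw [basisVec, lp.inner_single_left]
  simp

lemma basisVec_apply (c : Λ) (x y : G.Tail c) [Decidable (x = y)] :
    G.basisVec c x y = if x = y then 1 else 0 := by
  classical
  rw [basisVec, lp.single_apply]
  by_cases h : x = y
  · subst h; simp
  · simp [h, Ne.symm h]

lemma l2_ext {c : Λ} {g h : G.L2 c} (hgh : ∀ x, g x = h x) : g = h := lp.ext (funext hgh)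

lemma pull_act_basisVec (c w : Λ) (x : G.Tail c) :
    G.pull c w (G.basisVec c (G.act c w x)) = G.basisVec c x := by
  classical
  refine G.l2_ext fun y => ?_
  rw [pull_apply, basisVec_apply, basisVec_apply]
  by_cases h : x = y
  · subst h; simp
  · rw [if_neg h, if_neg fun h' => h (G.act_eq_act rfl h').2]

lemma pull_act_basisVec_of_ne (c : Λ) {w w' : Λ} (hd : G.d w = G.d w') (h : w ≠ w')
    (x : G.Tail c) : G.pull c w (G.basisVec c (G.act c w' x)) = 0 := by
  classical
  refine G.l2_ext fun y => ?_
  rw [pull_apply, basisVec_apply, if_neg fun h' => h (G.act_eq_act hd.symm h').1.symm]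
  rfl

lemma adjoint_pull_basisVec (c w : Λ) (x : G.Tail c) :
    ContinuousLinearMap.adjoint (G.pull c w) (G.basisVec c x) = G.basisVec c (G.act c w x) := by
  refine ext_inner_right ℂ fun g => ?_
  rw [ContinuousLinearMap.adjoint_inner_left, inner_basisVec, inner_basisVec, pull_apply]

/-- Pairing with basis vectors reads off coordinates, so the adjoints agree coordinatewise; no
density of the span of the basis is needed. -/
lemma operator_ext {c : Λ} {T T' : G.L2 c →L[ℂ] G.L2 c}
    (h : ∀ x, T (G.basisVec c x) = T' (G.basisVec c x)) : T = T' := by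
  have h' : ContinuousLinearMap.adjoint T = ContinuousLinearMap.adjoint T' := by
    refine ContinuousLinearMap.ext fun g => G.l2_ext fun x => ?_
    rw [← inner_basisVec, ← inner_basisVec, ContinuousLinearMap.adjoint_inner_right,
      ContinuousLinearMap.adjoint_inner_right, h]
  exact ContinuousLinearMap.adjoint.injective h'

/-- The representation of `Λ` on `ℓ²(X)`. -/
noncomputable def tailRep (c : Λ) : Λ →* (G.L2 c →L[ℂ] G.L2 c) where
  toFun w := ContinuousLinearMap.adjoint (G.pull c w)
  map_one' := G.operator_ext fun x => by
    rw [adjoint_pull_basisVec, act_one]; rfl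
  map_mul' w w' := G.operator_ext fun x => by
    rw [adjoint_pull_basisVec, act_mul, mul_apply_eq_comp, adjoint_pull_basisVec,
      adjoint_pull_basisVec]

lemma star_tailRep (c w : Λ) : star (G.tailRep c w) = G.pull c w :=
  ContinuousLinearMap.adjoint_adjoint _

lemma tailRep_basisVec (c w : Λ) (x : G.Tail c) :
    G.tailRep c w (G.basisVec c x) = G.basisVec c (G.act c w x) := G.adjoint_pull_basisVec c w x

lemma tailRep_isCuntzType {c : Λ} (hc : ∀ i, Pi.single i 1 ≤ G.d c) :
    G.IsCuntzType (G.tailRep c) where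
  star_mul_self i e := G.operator_ext fun x => by
    rw [star_tailRep, mul_apply_eq_comp, tailRep_basisVec, pull_act_basisVec]
    rfl
  star_mul_of_ne i e f h := G.operator_ext fun x => by
    rw [star_tailRep, mul_apply_eq_comp, tailRep_basisVec,
      pull_act_basisVec_of_ne _ _ (e.2.trans f.2.symm) fun h' => h (Subtype.ext h')]
    rfl
  sum_mul_star i := G.operator_ext fun y => by
    obtain ⟨e, x, rfl⟩ := G.exists_act_edge hc i y
    rw [sum_apply, Finset.sum_eq_single e]
    · rw [star_tailRep, mul_apply_eq_comp, pull_act_basisVec, tailRep_basisVec]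
      rfl
    · intro f _ hf
      rw [star_tailRep, mul_apply_eq_comp,
        pull_act_basisVec_of_ne _ _ (f.2.trans e.2.symm) fun h' => hf (Subtype.ext h'), map_zero]
    · simp

end Representation

/-- A state on a C*-algebra, as a continuous linear functional. -/
structure IsState {A : Type v} [CStarAlgebra A] (φ : A →L[ℂ] ℂ) : Prop where
  map_one : φ 1 = 1
  nonneg : ∀ a, ∃ r : ℝ, 0 ≤ r ∧ φ (star a * a) = r
  norm_le : ∀ a, ‖φ a‖ ≤ ‖a‖

/-- A vector state of the `ℓ²` representation. It is the raw material for the averaging below. -/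
lemma exists_state (hm : ∀ i, 1 < G.m i) : ∃ φ : G.Alg →L[ℂ] ℂ, IsState φ := by
  obtain ⟨c, hc⟩ := G.exists_degree_ge_one hm
  obtain ⟨π, -, -⟩ := G.existsUnique_lift (G.tailRep c) (G.tailRep_isCuntzType hc)
  set ξ := G.basisVec c (Quotient.mk _ (1, 0)) with hξ
  have hn : ‖ξ‖ = 1 := by
    classical
    rw [hξ, basisVec, lp.norm_single (by norm_num)]; simp
  have hb : ∀ a, ‖inner ℂ ξ (π a ξ)‖ ≤ ‖a‖ := fun a => by
    calc ‖inner ℂ ξ (π a ξ)‖ ≤ ‖ξ‖ * ‖π a ξ‖ := norm_inner_le_norm _ _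
      _ ≤ ‖π a‖ := by simpa [hn] using (π a).le_opNorm ξ
      _ ≤ ‖a‖ := NonUnitalStarAlgHom.norm_apply_le π a
  refine ⟨LinearMap.mkContinuous
    { toFun := fun a => inner ℂ ξ (π a ξ)
      map_add' := fun a b => by simp
      map_smul' := fun r a => by simp } 1 (by simpa using hb), ?_, ?_, ?_⟩
  · simp [hn]
  · intro a
    refine ⟨‖π a ξ‖ ^ 2, by positivity, ?_⟩
    change inner ℂ ξ (π (star a * a) ξ) = _
    rw [map_mul, map_star, mul_apply_eq_comp, ContinuousLinearMap.star_eq_adjoint,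
      ContinuousLinearMap.adjoint_inner_right, inner_self_eq_norm_sq_to_K]
    norm_cast
  · exact hb

/-! ### Averaging a state over words, and limits of states. -/

section States

/-- A sequence of states has a limit point in the set of states. -/
lemma exists_limit_state {A : Type v} [CStarAlgebra A] (f : ℕ → A →L[ℂ] ℂ)
    (hf : ∀ n, IsState (f n)) :
    ∃ L : A →L[ℂ] ℂ, IsState L ∧ ∀ a b, (∀ᶠ n in Filter.atTop, f n a = f n b) → L a = L b := by
  -- Along an ultrafilter all the bounded scalar sequences `f n a` converge at once; being
  -- nonprincipal, it also sees every property that holds eventually.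
  let U : Ultrafilter ℕ := Filter.hyperfilter ℕ
  have hlim : ∀ a, ∃ z : ℂ, Filter.Tendsto (fun n => f n a) U (nhds z) := by
    intro a
    obtain ⟨z, -, hz⟩ := (isCompact_closedBall (0 : ℂ) ‖a‖).ultrafilter_le_nhds
      (U.map fun n => f n a) (by
        rw [Filter.le_principal_iff]
        exact Filter.mem_map.2 (Filter.univ_mem' fun n => by
          simpa using (hf n).norm_le a))
    exact ⟨z, hz⟩
  choose L hL using hlim
  have hnorm : ∀ a, ‖L a‖ ≤ ‖a‖ := fun a =>
    le_of_tendsto (hL a).norm (Filter.Eventually.of_forall fun n => (hf n).norm_le a)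
  let L' : A →ₗ[ℂ] ℂ :=
    { toFun := L
      map_add' := fun a b => tendsto_nhds_unique (hL (a + b)) (by
        simpa using (hL a).add (hL b))
      map_smul' := fun c a => tendsto_nhds_unique (hL (c • a)) (by
        simpa using (hL a).const_mul c) }
  refine ⟨L'.mkContinuous 1 fun a => (hnorm a).trans_eq (one_mul _).symm, ⟨?_, ?_, hnorm⟩, ?_⟩
  · refine tendsto_nhds_unique (hL 1) ?_
    simp only [(hf _).map_one]
    exact tendsto_const_nhds
  · intro a
    have hcl : IsClosed {z : ℂ | 0 ≤ z.re ∧ z.im = 0} :=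
      (isClosed_le continuous_const Complex.continuous_re).inter
        (isClosed_eq Complex.continuous_im continuous_const)
    have h := hcl.mem_of_tendsto (hL (star a * a)) (Filter.Eventually.of_forall fun n => by
      obtain ⟨r, hr, h⟩ := (hf n).nonneg a
      rw [h]
      exact ⟨hr, rfl⟩)
    exact ⟨(L (star a * a)).re, h.1, Complex.ext rfl h.2⟩
  · intro a b hab
    refine tendsto_nhds_unique (hL a) ((hL b).congr' ?_)
    have := Nat.hyperfilter_le_atTop hab
    filter_upwards [this] with n hn
    exact hn.symm

variable {G}

/-- The average of the functionals `a ↦ ψ(s_w^* a s_w)` over the words `w` of degree `p`. -/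
noncomputable def averaged (ψ : G.Alg →L[ℂ] ℂ) (p : Fin k → ℕ) : G.Alg →L[ℂ] ℂ :=
  ((G.weight p)⁻¹ : ℂ) • ∑ w : G.Word p,
    ψ.comp (((ContinuousLinearMap.mul ℂ G.Alg).flip (G.s w)).comp
      (ContinuousLinearMap.mul ℂ G.Alg (star (G.s w))))

lemma averaged_apply (ψ : G.Alg →L[ℂ] ℂ) (p : Fin k → ℕ) (a : G.Alg) :
    averaged ψ p a = ((G.weight p)⁻¹ : ℂ) * ∑ w : G.Word p, ψ (star (G.s w) * a * G.s w) := by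
  simp [averaged]

lemma averaged_isState (hm : ∀ i, 1 < G.m i) {ψ : G.Alg →L[ℂ] ℂ} (hψ : IsState ψ)
    (p : Fin k → ℕ) : IsState (averaged ψ p) := by
  have hw := G.weight_pos hm p
  have hw' : (G.weight p : ℂ) ≠ 0 := by exact_mod_cast hw.ne'
  have hcard : (Fintype.card (G.Word p) : ℂ) = G.weight p := by exact_mod_cast G.card_word p
  refine ⟨?_, ?_, ?_⟩
  · simp only [averaged_apply, mul_one, G.s_isCuntzType.isometry, hψ.map_one, Finset.sum_const,
      Finset.card_univ, nsmul_eq_mul, hcard]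
    exact inv_mul_cancel₀ hw'
  · intro a
    have h : ∀ w : G.Word p, ∃ r : ℝ, 0 ≤ r ∧ ψ (star (G.s w) * (star a * a) * G.s w) = r := by
      intro w
      have := hψ.nonneg (a * G.s w)
      rwa [star_mul, mul_assoc, ← mul_assoc (star a), ← mul_assoc] at this
    choose r hr h using h
    refine ⟨(G.weight p)⁻¹ * ∑ w, r w,
      mul_nonneg (inv_nonneg.2 hw.le) (Finset.sum_nonneg fun w _ => hr w), ?_⟩
    rw [averaged_apply, Finset.sum_congr rfl fun w _ => h w]
    push_cast
    rfl
  · intro a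
    have h : ∀ w : G.Word p, ‖ψ (star (G.s w) * a * G.s w)‖ ≤ ‖a‖ := fun w => by
      refine (hψ.norm_le _).trans ?_
      calc _ ≤ ‖star (G.s w)‖ * ‖a‖ * ‖G.s w‖ :=
            (norm_mul_le _ _).trans (mul_le_mul_of_nonneg_right (norm_mul_le _ _) (norm_nonneg _))
        _ ≤ 1 * ‖a‖ * 1 := by
          have := G.norm_s_le w
          rw [norm_star]
          gcongr
        _ = ‖a‖ := by simp
    rw [averaged_apply, norm_mul]
    calc _ ≤ (G.weight p)⁻¹ * (G.weight p * ‖a‖) := by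
          gcongr
          · simp [abs_of_pos hw]
          · refine (norm_sum_le_of_le _ fun w _ => h w).trans ?_
            rw [Finset.sum_const, Finset.card_univ, nsmul_eq_mul, G.card_word]
      _ = ‖a‖ := by rw [← mul_assoc, inv_mul_cancel₀ hw.ne', one_mul]

/-- By orthogonality of words of equal degree, only `w = u` survives on the left and only `w = v` on
the right; both surviving terms are `ψ(s_v^* b s_u)`. -/
lemma averaged_mono_mul (ψ : G.Alg →L[ℂ] ℂ) {p : Fin k → ℕ} {u v : Λ} (hu : G.d u = p)
    (hv : G.d v = p) (b : G.Alg) :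
    averaged ψ p (G.mono u v * b) = averaged ψ p (b * G.mono u v) := by
  have h1 : ∑ w : G.Word p, ψ (star (G.s w) * (G.mono u v * b) * G.s w) =
      ψ (star (G.s v) * b * G.s u) := by
    rw [Finset.sum_eq_single ⟨u, hu⟩]
    · rw [mono, mul_assoc (G.s u), ← mul_assoc (star (G.s u)), G.s_isCuntzType.isometry, one_mul]
    · intro w _ hw
      rw [mono, mul_assoc (G.s u), ← mul_assoc (star (G.s w)),
        G.s_isCuntzType.star_mul_of_ne_word (w.2.trans hu.symm) fun h => hw (Subtype.ext h),
        zero_mul, zero_mul, map_zero]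
    · simp
  have h2 : ∑ w : G.Word p, ψ (star (G.s w) * (b * G.mono u v) * G.s w) =
      ψ (star (G.s v) * b * G.s u) := by
    rw [Finset.sum_eq_single ⟨v, hv⟩]
    · rw [mono, ← mul_assoc b, ← mul_assoc, mul_assoc _ (star (G.s v)) (G.s v),
        G.s_isCuntzType.isometry, mul_one, mul_assoc]
    · intro w _ hw
      rw [mono, ← mul_assoc b, ← mul_assoc, mul_assoc _ (star (G.s v)) (G.s w),
        G.s_isCuntzType.star_mul_of_ne_word (hv.trans w.2.symm) fun h => hw (Subtype.ext h.symm),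
        mul_zero, map_zero]
    · simp
  rw [averaged_apply, averaged_apply, h1, h2]

/-- A state of `O_θ` whose centralizer contains the monomials of degree zero. -/
lemma exists_central_state (hm : ∀ i, 1 < G.m i) :
    ∃ L : G.Alg →L[ℂ] ℂ, IsState L ∧
      ∀ u v, G.d u = G.d v → ∀ b, L (G.mono u v * b) = L (b * G.mono u v) := by
  obtain ⟨ψ, hψ⟩ := G.exists_state hm
  obtain ⟨L, hL, h⟩ := exists_limit_state (fun n : ℕ => averaged ψ fun _ => n)
    fun n => averaged_isState hm hψ _
  refine ⟨L, hL, fun u v huv b => h _ _ ?_⟩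
  filter_upwards [Filter.eventually_ge_atTop (∑ i, G.d u i)] with n hn
  have hle : G.d u ≤ fun _ => n := fun i =>
    (Finset.single_le_sum (f := G.d u) (fun j _ => Nat.zero_le _) (Finset.mem_univ i)).trans hn
  -- For large `n` both words can be lengthened to degree `(n, …, n)`, where the average commutes
  -- with the monomials.
  rw [G.mono_eq_sum u v ((fun _ => n) - G.d u), Finset.sum_mul, Finset.mul_sum, map_sum, map_sum]
  refine Finset.sum_congr rfl fun w _ => averaged_mono_mul ψ ?_ ?_ b
  · rw [G.d_mul, w.2, add_tsub_cancel_of_le hle]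
  · rw [G.d_mul, w.2, ← huv, add_tsub_cancel_of_le hle]

end States

/-! ### Fixed point algebras are spanned by fixed monomials. -/

section FixedPoints

variable {G}

lemma isometry_starAlgEquiv {A : Type v} [CStarAlgebra A] (α : A ≃⋆ₐ[ℂ] A) : Isometry α :=
  NonUnitalStarAlgHom.isometry _ α.injective

lemma isClosed_fixedPoints {ι : Type*} {A : Type v} [CStarAlgebra A] (α : ι → (A ≃⋆ₐ[ℂ] A)) :
    IsClosed (fixedPoints α : Set A) := by
  have : (fixedPoints α : Set A) = ⋂ t, {a | α t a = a} := by
    ext a; simp only [Set.mem_iInter]; rfl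
  rw [this]
  exact isClosed_iInter fun t => isClosed_eq
    (isometry_starAlgEquiv (α t)).continuous continuous_id

/-- If every monomial is fixed by `α` or is multiplied by `-1` by some `α t`, then the fixed
monomials span a dense subspace of the fixed point algebra. -/
lemma mem_closure_span_fixed {ι : Type*} (α : ι → (G.Alg ≃⋆ₐ[ℂ] G.Alg)) (p : Λ → Λ → Prop)
    (hfix : ∀ u v, p u v → ∀ t, α t (G.mono u v) = G.mono u v)
    (hneg : ∀ u v, ¬ p u v → ∃ t, α t (G.mono u v) = -G.mono u v)
    (heig : ∀ t u v, ∃ c : ℂ, α t (G.mono u v) = c • G.mono u v)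
    {a : G.Alg} (ha : a ∈ fixedPoints α) :
    a ∈ closure (Submodule.span ℂ {x | ∃ u v, p u v ∧ x = G.mono u v} : Set G.Alg) := by
  classical
  set V := Submodule.span ℂ {x | ∃ u v, p u v ∧ x = G.mono u v} with hV
  have hnorm : ∀ t x, ‖α t x‖ = ‖x‖ := fun t x =>
    (isometry_starAlgEquiv (α t)).norm_map_of_map_zero (map_zero _) x
  have hVfix : ∀ t, ∀ x ∈ V, α t x = x := by
    intro t x hx
    induction hx using Submodule.span_induction with
    | mem x hx => obtain ⟨u, v, h, rfl⟩ := hx; exact hfix u v h t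
    | zero => exact map_zero _
    | add x y _ _ h1 h2 => rw [map_add, h1, h2]
    | smul c x _ h => rw [map_smul, h]
  -- A substitute for an invariant mean: composing finitely many operators `(1 + α_t)/2` gives a
  -- contraction that is the identity on fixed points, is diagonal on monomials, and kills the
  -- non-fixed monomials of a given finite set. Applied to a finite combination close to `a`, it
  -- yields a combination of fixed monomials that is just as close.
  have key : ∀ s : Finset (Λ × Λ), ∃ T : G.Alg →ₗ[ℂ] G.Alg, (∀ x, ‖T x‖ ≤ ‖x‖) ∧
      (∀ x ∈ fixedPoints α, T x = x) ∧ (∀ u v, ∃ c : ℂ, T (G.mono u v) = c • G.mono u v) ∧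
      ∀ y ∈ s, T (G.mono y.1 y.2) ∈ V := by
    intro s
    induction s using Finset.induction_on with
    | empty => exact ⟨LinearMap.id, fun _ => le_rfl, fun _ _ => rfl,
        fun u v => ⟨1, by simp⟩, by simp⟩
    | insert y s _ ih =>
      obtain ⟨T, h1, h2, h3, h4⟩ := ih
      by_cases hy : p y.1 y.2
      · refine ⟨T, h1, h2, h3, fun z hz => ?_⟩
        rcases Finset.mem_insert.1 hz with rfl | hz
        · obtain ⟨c, hc⟩ := h3 z.1 z.2
          rw [hc]
          exact V.smul_mem _ (Submodule.subset_span ⟨_, _, hy, rfl⟩)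
        · exact h4 z hz
      · obtain ⟨t, ht⟩ := hneg _ _ hy
        let R : G.Alg →ₗ[ℂ] G.Alg := ((1 / 2 : ℂ)) • (LinearMap.id +
          { toFun := α t, map_add' := map_add _, map_smul' := map_smul _ })
        have hR : ∀ x, R x = (1 / 2 : ℂ) • (x + α t x) := fun _ => rfl
        have hRfix : ∀ x, α t x = x → R x = x := fun x hx => by
          rw [hR, hx, ← two_smul ℂ x, smul_smul]; norm_num
        refine ⟨R.comp T, fun x => ?_, fun x hx => ?_, fun u v => ?_, fun z hz => ?_⟩
        · rw [LinearMap.comp_apply, hR, norm_smul]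
          have := norm_add_le (T x) (α t (T x))
          rw [hnorm] at this
          have h3 : ‖(1 / 2 : ℂ)‖ = 1 / 2 := by norm_num
          rw [h3]
          linarith [h1 x]
        · rw [LinearMap.comp_apply, h2 x hx, hRfix x (hx t)]
        · obtain ⟨c, hc⟩ := h3 u v
          obtain ⟨c', hc'⟩ := heig t u v
          refine ⟨(1 / 2 : ℂ) * (c + c * c'), ?_⟩
          rw [LinearMap.comp_apply, hR, hc, map_smul, hc', smul_smul, ← add_smul, smul_smul]
        · rw [LinearMap.comp_apply]
          rcases Finset.mem_insert.1 hz with rfl | hz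
          · obtain ⟨c, hc⟩ := h3 z.1 z.2
            rw [hR, hc, map_smul, ht, smul_neg, add_neg_cancel, smul_zero]
            exact V.zero_mem
          · rw [hRfix _ (hVfix t _ (h4 z hz))]
            exact h4 z hz
  rw [Metric.mem_closure_iff]
  intro ε hε
  obtain ⟨x, hx, hax⟩ := Metric.mem_closure_iff.1 (G.dense_span_mono a) ε hε
  obtain ⟨l, rfl⟩ := (Finsupp.mem_span_range_iff_exists_finsupp).1 hx
  obtain ⟨T, h1, h2, -, h4⟩ := key l.support
  refine ⟨T (l.sum fun i c => c • G.mono i.1 i.2), ?_, ?_⟩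
  · rw [Finsupp.sum, map_sum]
    refine V.sum_mem fun y hy => ?_
    rw [map_smul]
    exact V.smul_mem _ (h4 y hy)
  · rw [dist_eq_norm] at hax ⊢
    refine lt_of_le_of_lt ?_ hax
    conv_lhs => rw [← h2 a ha]
    rw [← map_sub]
    exact h1 _

end FixedPoints

/-! ### Gauge and modular actions on monomials. -/

section Gauge

lemma gauge_mono (t : Fin k → Circle) (u v : Λ) :
    G.gauge t (G.mono u v) = ((G.character t u / G.character t v : Circle) : ℂ) • G.mono u v := by
  rw [mono, map_mul, map_star, gauge_s, gauge_s, star_smul, smul_mul_smul_comm, Circle.coe_div,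
    div_eq_mul_inv, ← Circle.coe_inv, Circle.coe_inv_eq_conj]
  rfl

lemma character_exp (x : Fin k → ℝ) (w : Λ) :
    G.character (fun i => Circle.exp (x i)) w = Circle.exp (∑ i, x i * G.d w i) := by
  change ∏ i, Circle.exp (x i) ^ G.d w i = _
  have : ∀ s : Finset (Fin k), ∏ i ∈ s, Circle.exp (x i) ^ G.d w i =
      Circle.exp (∑ i ∈ s, x i * G.d w i) := by
    intro s
    classical
    induction s using Finset.induction_on with
    | empty => simp
    | insert i s hi ih =>
      rw [Finset.prod_insert hi, Finset.sum_insert hi, Circle.exp_add, ih]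
      congr 1
      rw [mul_comm, ← nsmul_eq_mul]
      exact (map_nsmul Circle.expHom (G.d w i) (x i)).symm
  exact this _

lemma gauge_exp_mono (x : Fin k → ℝ) (u v : Λ) :
    G.gauge (fun i => Circle.exp (x i)) (G.mono u v) =
      (Circle.exp (∑ i, x i * G.d u i - ∑ i, x i * G.d v i) : ℂ) • G.mono u v := by
  rw [gauge_mono, character_exp, character_exp, Circle.exp_sub]

lemma gauge_mono_of_d_eq (t : Fin k → Circle) {u v : Λ} (h : G.d u = G.d v) :
    G.gauge t (G.mono u v) = G.mono u v := by
  have : G.character t u = G.character t v := by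
    change ∏ i, t i ^ G.d u i = ∏ i, t i ^ G.d v i
    rw [h]
  rw [gauge_mono, this, div_self', Circle.coe_one, one_smul]

lemma mono_mem_core {u v : Λ} (h : G.d u = G.d v) : G.mono u v ∈ G.core :=
  fun t => G.gauge_mono_of_d_eq t h

lemma exists_gauge_mono_eq_neg {u v : Λ} (h : G.d u ≠ G.d v) :
    ∃ t, G.gauge t (G.mono u v) = -G.mono u v := by
  obtain ⟨i, hi⟩ := Function.ne_iff.1 h
  have hi' : (G.d u i : ℝ) - G.d v i ≠ 0 := sub_ne_zero.2 (by exact_mod_cast hi)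
  -- Rotate a colour `i` on which the degrees differ, by the angle that makes the eigenvalue
  -- `exp(iπ) = -1`.
  refine ⟨fun j => Circle.exp (Pi.single (M := fun _ => ℝ) i
    (Real.pi / ((G.d u i : ℝ) - G.d v i)) j), ?_⟩
  have hs : ∀ w : Λ, ∑ j, Pi.single (M := fun _ => ℝ) i (Real.pi / ((G.d u i : ℝ) - G.d v i)) j *
      (G.d w j : ℝ) = Real.pi / ((G.d u i : ℝ) - G.d v i) * G.d w i := by
    intro w
    rw [Finset.sum_eq_single i]
    · simp
    · intro j _ hj; simp [hj]
    · simp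
  rw [gauge_exp_mono, hs, hs, ← mul_sub, div_mul_cancel₀ _ hi', Circle.coe_exp,
    Complex.exp_pi_mul_I, neg_one_smul]

lemma mem_closure_of_mem_core {a : G.Alg} (ha : a ∈ G.core) :
    a ∈ closure (Submodule.span ℂ {x | ∃ u v, G.d u = G.d v ∧ x = G.mono u v} : Set G.Alg) :=
  mem_closure_span_fixed G.gauge (fun u v => G.d u = G.d v)
    (fun _ _ h t => G.gauge_mono_of_d_eq t h) (fun _ _ h => G.exists_gauge_mono_eq_neg h)
    (fun t u v => ⟨_, G.gauge_mono t u v⟩) ha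

variable {G}

lemma log_weight (hm : ∀ i, 1 < G.m i) (p : Fin k → ℕ) :
    Real.log (G.weight p) = ∑ i, Real.log (G.m i) * p i := by
  rw [weight, Real.log_prod]
  · simp [mul_comm]
  · intro i _
    have : G.m i ≠ 0 := by have := hm i; omega
    positivity

lemma modularFlow_mono (hm : ∀ i, 1 < G.m i) (t : ℝ) (u v : Λ) :
    G.modularFlow t (G.mono u v) = (Circle.exp
      (t * (Real.log (G.weight (G.d v)) - Real.log (G.weight (G.d u)))) : ℂ) • G.mono u v := by
  have h : ∀ w : Λ, ∑ i, -(t * Real.log (G.m i)) * (G.d w i : ℝ) =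
      -(t * Real.log (G.weight (G.d w))) := fun w => by
    rw [log_weight hm, Finset.mul_sum, ← Finset.sum_neg_distrib]
    exact Finset.sum_congr rfl fun i _ => by ring
  rw [modularFlow, gauge_exp_mono, h, h]
  congr 3
  ring

lemma mono_mem_modularFixed (hm : ∀ i, 1 < G.m i) {u v : Λ}
    (h : G.weight (G.d u) = G.weight (G.d v)) : G.mono u v ∈ G.modularFixed := by
  intro t
  rw [modularFlow_mono hm, h, sub_self, mul_zero, Circle.exp_zero, Circle.coe_one, one_smul]

lemma mem_closure_of_mem_modularFixed (hm : ∀ i, 1 < G.m i) {a : G.Alg}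
    (ha : a ∈ G.modularFixed) :
    a ∈ closure (Submodule.span ℂ
      {x | ∃ u v, G.weight (G.d u) = G.weight (G.d v) ∧ x = G.mono u v} : Set G.Alg) := by
  refine mem_closure_span_fixed G.modularFlow (fun u v => G.weight (G.d u) = G.weight (G.d v))
    (fun _ _ h => mono_mem_modularFixed hm h) (fun u v h => ?_)
    (fun t u v => ⟨_, modularFlow_mono hm t u v⟩) ha
  have hne : Real.log (G.weight (G.d v)) - Real.log (G.weight (G.d u)) ≠ 0 :=
    sub_ne_zero.2 fun h' =>
      h (Real.log_injOn_pos (G.weight_pos hm _) (G.weight_pos hm _) h').symm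
  -- At this time the eigenvalue of the flow on the monomial is `exp(iπ) = -1`.
  refine ⟨Real.pi / (Real.log (G.weight (G.d v)) - Real.log (G.weight (G.d u))), ?_⟩
  rw [modularFlow_mono hm, div_mul_cancel₀ _ hne, Circle.coe_exp, Complex.exp_pi_mul_I,
    neg_one_smul]

variable (G)

lemma norm_gauge (t : Fin k → Circle) (a : G.Alg) : ‖G.gauge t a‖ = ‖a‖ :=
  (isometry_starAlgEquiv (G.gauge t)).norm_map_of_map_zero (map_zero _) a

lemma continuous_gauge (a : G.Alg) : Continuous fun t : Fin k → Circle => G.gauge t a := by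
  have hspan : ∀ x ∈ Submodule.span ℂ (Set.range fun x : Λ × Λ => G.mono x.1 x.2),
      Continuous fun t : Fin k → Circle => G.gauge t x := by
    intro x hx
    induction hx using Submodule.span_induction with
    | mem x hx =>
      obtain ⟨⟨u, v⟩, rfl⟩ := hx
      simp only [gauge_mono]
      have hc : ∀ w : Λ, Continuous fun t : Fin k → Circle => G.character t w := fun w => by
        change Continuous fun t : Fin k → Circle => ∏ i, t i ^ G.d w i
        fun_prop
      exact (continuous_subtype_val.comp ((hc u).div' (hc v))).smul continuous_const
    | zero => simp only [map_zero]; exact continuous_const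
    | add x y _ _ h1 h2 => simp only [map_add]; exact h1.add h2
    | smul c x _ h => simp only [map_smul]; exact h.const_smul c
  refine continuous_of_uniform_approx_of_continuous fun s hs => ?_
  obtain ⟨ε, hε, hεs⟩ := Metric.mem_uniformity_dist.1 hs
  obtain ⟨x, hx, hax⟩ := Metric.mem_closure_iff.1 (G.dense_span_mono a) ε hε
  refine ⟨_, hspan x hx, fun t => hεs ?_⟩
  rwa [(isometry_starAlgEquiv (G.gauge t)).dist_eq]

end Gauge

/-! ### The expectation onto the core. -/

section Expectation

open MeasureTheory

lemma integrable_gauge (a : G.Alg) :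
    Integrable (fun x : UnitAddTorus (Fin k) => G.gauge (fun i => (x i).toCircle) a)
      (Measure.pi fun _ => AddCircle.haarAddCircle) := by
  have h : Continuous fun x : UnitAddTorus (Fin k) => G.gauge (fun i => (x i).toCircle) a :=
    (G.continuous_gauge a).comp (continuous_pi fun i =>
      AddCircle.continuous_toCircle.comp (continuous_apply i))
  exact h.integrable_of_hasCompactSupport (HasCompactSupport.of_compactSpace _)

/-- The expectation as a continuous linear map. -/
noncomputable def expectationL : G.Alg →L[ℂ] G.Alg :=
  LinearMap.mkContinuous
    { toFun := G.expectation
      map_add' := fun a b => by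
        simp only [expectation, map_add]
        exact integral_add (G.integrable_gauge a) (G.integrable_gauge b)
      map_smul' := fun c a => by
        simp only [expectation, map_smul]
        exact integral_smul c _ } 1 fun a => by
    refine (norm_integral_le_of_norm_le_const (C := ‖a‖)
      (Filter.Eventually.of_forall fun x => (G.norm_gauge _ a).le)).trans ?_
    simp

@[simp] lemma expectationL_apply (a : G.Alg) : G.expectationL a = G.expectation a := rfl

lemma norm_expectation_le (a : G.Alg) : ‖G.expectation a‖ ≤ ‖a‖ := by
  have := norm_integral_le_of_norm_le_const
    (μ := Measure.pi fun _ : Fin k => AddCircle.haarAddCircle (T := 1))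
    (f := fun x : UnitAddTorus (Fin k) => G.gauge (fun i => (x i).toCircle) a) (C := ‖a‖)
    (Filter.Eventually.of_forall fun x => (G.norm_gauge _ a).le)
  exact this.trans_eq (by simp)

lemma expectation_of_mem_core {a : G.Alg} (ha : a ∈ G.core) : G.expectation a = a := by
  have : ∀ t, G.gauge t a = a := ha
  simp [expectation, this]

/-- The expectation is a multiple of the monomial; it is gauge invariant, yet some gauge
automorphism changes its sign. -/
lemma expectation_mono_of_ne {u v : Λ} (h : G.d u ≠ G.d v) : G.expectation (G.mono u v) = 0 := by
  have hc : ∃ c : ℂ, G.expectation (G.mono u v) = c • G.mono u v := by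
    simp only [expectation, gauge_mono]
    exact ⟨_, integral_smul_const _ _⟩
  obtain ⟨c, hc⟩ := hc
  obtain ⟨t, ht⟩ := G.exists_gauge_mono_eq_neg h
  have h1 := G.expectation_mem_core (G.mono u v) t
  rw [hc, map_smul, ht, smul_neg] at h1
  rw [hc]
  have h2 : (2 : ℂ) • c • G.mono u v = 0 := by
    rw [two_smul]
    nth_rewrite 1 [← h1]
    exact neg_add_cancel _
  exact (smul_eq_zero.1 h2).resolve_left two_ne_zero

lemma expectation_gauge (t : Fin k → Circle) (a : G.Alg) :
    G.expectation (G.gauge t a) = G.expectation a := by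
  let T : G.Alg →L[ℂ] G.Alg := LinearMap.mkContinuous
    { toFun := G.gauge t, map_add' := map_add _, map_smul' := map_smul _ } 1
    fun x => by simpa using (G.norm_gauge t x).le
  have : G.expectationL.comp T = G.expectationL := by
    refine G.clm_ext fun u v => ?_
    change G.expectation (G.gauge t (G.mono u v)) = G.expectation (G.mono u v)
    by_cases h : G.d u = G.d v
    · rw [gauge_mono_of_d_eq _ _ h]
    · rw [gauge_mono, ← expectationL_apply, map_smul, expectationL_apply,
        G.expectation_mono_of_ne h, smul_zero]
  exact DFunLike.congr_fun this a

lemma isState_comp_expectation {L : G.Alg →L[ℂ] ℂ} (hL : IsState L) :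
    IsState (L.comp G.expectationL) := by
  refine ⟨?_, fun a => ?_, fun a => (hL.norm_le _).trans (G.norm_expectation_le a)⟩
  · change L (G.expectation 1) = 1
    rw [G.expectation_of_mem_core (one_mem _), hL.map_one]
  · have h : ∀ x : UnitAddTorus (Fin k), ∃ r : ℝ, 0 ≤ r ∧
        L (G.gauge (fun i => (x i).toCircle) (star a * a)) = r := fun x => by
      rw [map_mul, map_star]; exact hL.nonneg _
    choose r hr h using h
    refine ⟨∫ x, r x ∂(Measure.pi fun _ => AddCircle.haarAddCircle), integral_nonneg hr, ?_⟩
    change L (G.expectation (star a * a)) = _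
    rw [expectation, ← L.integral_comp_comm (G.integrable_gauge _)]
    simp only [h]
    exact integral_ofReal

end Expectation

/-! ### Tracial states: contractivity and values on degree-zero monomials. -/

section TracialStates

namespace IsTracialState

variable {A : Type v} [CStarAlgebra A] {φ : A →ₗ[ℂ] ℂ}

/-- That `φ` is real on `x^* x` for `x = a + 1` and `x = a + i` controls the imaginary and the real
part of `φ(a^*) - conj φ(a)` respectively. -/
lemma map_star (hφ : IsTracialState φ) (a : A) : φ (star a) = star (φ a) := by
  have h1 := hφ.im_eq_zero (a + 1)
  have h2 := hφ.im_eq_zero (a + Complex.I • 1)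
  have e1 : star (a + 1) * (a + 1) = star a * a + star a + a + 1 := by
    simp only [star_add, star_one, add_mul, mul_add, mul_one, one_mul]; abel
  have e2 : star (a + Complex.I • 1) * (a + Complex.I • 1) =
      star a * a + Complex.I • star a - Complex.I • a + 1 := by
    have hI : star Complex.I = -Complex.I := Complex.conj_I
    simp only [star_add, star_smul, star_one, add_mul, mul_add, mul_smul_comm, smul_mul_assoc,
      mul_one, one_mul, smul_add, smul_smul, hI, neg_smul, smul_neg, Complex.I_mul_I, neg_neg,
      one_smul, neg_mul]
    abel
  rw [e1] at h1
  rw [e2] at h2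
  simp only [map_add, map_sub, map_smul, hφ.map_one, Complex.add_im, Complex.sub_im,
    hφ.im_eq_zero a, smul_eq_mul, Complex.mul_im, Complex.I_re, Complex.I_im, Complex.one_im] at h1 h2
  refine Complex.ext ?_ ?_
  · rw [Complex.star_def, Complex.conj_re]; linarith
  · rw [Complex.star_def, Complex.conj_im]; linarith

/-- Cauchy–Schwarz against the unit, from positivity at `a - φ(a) 1`. -/
lemma norm_sq_le (hφ : IsTracialState φ) (a : A) : ‖φ a‖ ^ 2 ≤ (φ (star a * a)).re := by
  have h := hφ.re_nonneg (a - φ a • 1)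
  have e : star (a - φ a • 1) * (a - φ a • 1) =
      star a * a - φ a • star a - star (φ a) • a + (star (φ a) * φ a) • 1 := by
    simp only [star_sub, star_smul, star_one, sub_mul, mul_sub, mul_smul_comm, smul_mul_assoc,
      mul_one, one_mul, smul_sub, smul_smul]
    rw [mul_comm (star (φ a))]
    abel
  rw [e] at h
  simp only [map_add, map_sub, map_smul, hφ.map_one, hφ.map_star, smul_eq_mul, mul_one] at h
  have h3 : star (φ a) * φ a = ((‖φ a‖ ^ 2 : ℝ) : ℂ) := by
    rw [Complex.star_def, ← Complex.normSq_eq_conj_mul_self, Complex.normSq_eq_norm_sq]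
  rw [mul_comm (φ a), h3] at h
  simp only [Complex.add_re, Complex.sub_re, Complex.ofReal_re] at h
  linarith

/-- Tracial states are defined algebraically, so the continuity needed for density arguments has to
be proved: `‖a‖² - a^* a` is some `b^* b`, and `norm_sq_le` finishes. -/
lemma norm_le (hφ : IsTracialState φ) (a : A) : ‖φ a‖ ≤ ‖a‖ := by
  let _ := CStarAlgebra.spectralOrder A
  have := CStarAlgebra.spectralOrderedRing A
  have h := CStarAlgebra.star_mul_le_algebraMap_norm_sq (a := a)
  obtain ⟨b, hb⟩ := CStarAlgebra.nonneg_iff_eq_star_mul_self.1 (sub_nonneg.2 h)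
  have h1 := hφ.re_nonneg b
  rw [← hb, map_sub, Algebra.algebraMap_eq_smul_one, ← Complex.coe_smul, map_smul, hφ.map_one,
    smul_eq_mul, mul_one, Complex.sub_re, Complex.ofReal_re] at h1
  have h2 := hφ.norm_sq_le a
  exact abs_le_of_sq_le_sq' (by linarith) (norm_nonneg _) |>.2

end IsTracialState

variable {G}

lemma isClosed_core : IsClosed (G.core : Set G.Alg) := isClosed_fixedPoints _

lemma isClosed_modularFixed : IsClosed (G.modularFixed : Set G.Alg) := isClosed_fixedPoints _

/-- Bounded functionals on a subalgebra which agree on a family spanning a dense subspace. -/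
lemma functional_ext {A : Type v} [CStarAlgebra A] {B : StarSubalgebra ℂ A} {φ ψ : B →ₗ[ℂ] ℂ}
    (hφ : ∀ a, ‖φ a‖ ≤ ‖a‖) (hψ : ∀ a, ‖ψ a‖ ≤ ‖a‖) {s : Set A} (hs : s ⊆ B)
    (hd : ∀ a ∈ B, a ∈ closure (Submodule.span ℂ s : Set A))
    (h : ∀ x (hx : x ∈ s), φ ⟨x, hs hx⟩ = ψ ⟨x, hs hx⟩) : φ = ψ := by
  have hle : Submodule.span ℂ s ≤ Subalgebra.toSubmodule B.toSubalgebra := Submodule.span_le.2 hs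
  have hspan : ∀ x (hx : x ∈ Submodule.span ℂ s), φ ⟨x, hle hx⟩ = ψ ⟨x, hle hx⟩ := by
    intro x hx
    induction hx using Submodule.span_induction with
    | mem x hx => exact h x hx
    | zero => exact (map_zero φ).trans (map_zero ψ).symm
    | add x y hx hy h1 h2 =>
      have := congrArg₂ (· + ·) h1 h2
      simp only [← map_add] at this
      exact this
    | smul c x hx h =>
      have := congrArg (c • ·) h
      simp only [← map_smul] at this
      exact this
  refine LinearMap.ext fun a => eq_of_forall_dist_le fun ε hε => ?_
  obtain ⟨x, hx, hax⟩ := Metric.mem_closure_iff.1 (hd a a.2) (ε / 2) (half_pos hε)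
  have h1 : ‖a - ⟨x, hle hx⟩‖ < ε / 2 := by rwa [dist_eq_norm] at hax
  have e : φ a - ψ a = φ (a - ⟨x, hle hx⟩) - ψ (a - ⟨x, hle hx⟩) := by
    rw [map_sub, map_sub, hspan x hx]; ring
  rw [dist_eq_norm, e]
  refine (norm_sub_le _ _).trans ?_
  have := hφ (a - ⟨x, hle hx⟩)
  have := hψ (a - ⟨x, hle hx⟩)
  linarith

section Values

variable {B : StarSubalgebra ℂ G.Alg} {φ : B →ₗ[ℂ] ℂ}

/-- Multiply on the right by the projection `s_v s_v^*` and move it to the left by the trace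
property; there it annihilates `s_u`. -/
lemma IsTracialState.map_mono_of_ne (hφ : IsTracialState φ) (hB : G.core ≤ B) {u v : Λ}
    (hd : G.d u = G.d v) (hne : u ≠ v) (h : G.mono u v ∈ B) : φ ⟨G.mono u v, h⟩ = 0 := by
  have e1 : (⟨G.mono u v, h⟩ : B) =
      ⟨G.mono u v, h⟩ * ⟨G.mono v v, hB (G.mono_mem_core rfl)⟩ :=
    Subtype.ext (G.mono_mul_mono u v v).symm
  have e2 : (⟨G.mono v v, hB (G.mono_mem_core rfl)⟩ : B) * ⟨G.mono u v, h⟩ = 0 :=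
    Subtype.ext (G.mono_mul_mono_of_ne hd.symm hne.symm)
  rw [e1, hφ.tracial, e2, map_zero]

/-- The projections `s_w s_w^*` with `d(w) = d(u)` are equivalent through monomials of the core,
they sum to `1`, and there are `m^{d(u)}` of them. -/
lemma IsTracialState.map_mono_self (hφ : IsTracialState φ)
    (hB : G.core ≤ B) (u : Λ) (h : G.mono u u ∈ B) :
    φ ⟨G.mono u u, h⟩ = ((G.weight (G.d u))⁻¹ : ℂ) := by
  have hmem : ∀ w : G.Word (G.d u), G.mono (w : Λ) w ∈ B := fun w => hB (G.mono_mem_core rfl)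
  have e1 : ∀ w : G.Word (G.d u), φ ⟨G.mono (w : Λ) w, hmem w⟩ = φ ⟨G.mono u u, h⟩ := by
    intro w
    have h1 : (⟨G.mono (w : Λ) w, hmem w⟩ : B) = ⟨G.mono w u, hB (G.mono_mem_core w.2)⟩ *
        ⟨G.mono u w, hB (G.mono_mem_core w.2.symm)⟩ := Subtype.ext (G.mono_mul_mono _ _ _).symm
    have h2 : (⟨G.mono u u, h⟩ : B) = ⟨G.mono u w, hB (G.mono_mem_core w.2.symm)⟩ *
        ⟨G.mono w u, hB (G.mono_mem_core w.2)⟩ := Subtype.ext (G.mono_mul_mono _ _ _).symm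
    rw [h1, h2, hφ.tracial]
  have e2 : ∑ w : G.Word (G.d u), (⟨G.mono (w : Λ) w, hmem w⟩ : B) = 1 := Subtype.ext <| by
    rw [AddSubmonoidClass.coe_finsetSum]
    exact G.sum_mono _
  have e3 := congrArg φ e2
  rw [map_sum, Finset.sum_congr rfl fun w _ => e1 w, Finset.sum_const, Finset.card_univ,
    nsmul_eq_mul, hφ.map_one] at e3
  have hcard : (Fintype.card (G.Word (G.d u)) : ℂ) = G.weight (G.d u) := by
    exact_mod_cast G.card_word _
  rw [hcard] at e3
  exact eq_inv_of_mul_eq_one_right e3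

end Values

lemma tracialState_core_unique {φ ψ : G.core →ₗ[ℂ] ℂ}
    (hφ : IsTracialState φ) (hψ : IsTracialState ψ) : φ = ψ := by
  -- Closedness makes the core a C*-algebra, so `IsTracialState.norm_le` applies to it.
  have := isClosed_core (G := G)
  refine functional_ext hφ.norm_le hψ.norm_le
    (s := {x | ∃ u v, G.d u = G.d v ∧ x = G.mono u v})
    (by rintro _ ⟨u, v, h, rfl⟩; exact G.mono_mem_core h)
    (fun a ha => G.mem_closure_of_mem_core ha) ?_
  rintro _ ⟨u, v, h, rfl⟩
  by_cases huv : u = v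
  · subst huv
    rw [hφ.map_mono_self le_rfl, hψ.map_mono_self le_rfl]
  · rw [hφ.map_mono_of_ne le_rfl h huv, hψ.map_mono_of_ne le_rfl h huv]

/-- Restriction of a state to a star subalgebra in its centralizer. -/
lemma IsState.isTracialState_comp_subtype {φ : G.Alg →L[ℂ] ℂ} (hφ : IsState φ)
    {B : StarSubalgebra ℂ G.Alg} {p : Λ → Λ → Prop}
    (hB : ∀ a ∈ B, a ∈ closure (Submodule.span ℂ {x | ∃ u v, p u v ∧ x = G.mono u v} : Set G.Alg))
    (h : ∀ u v, p u v → ∀ b, φ (G.mono u v * b) = φ (b * G.mono u v)) :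
    IsTracialState (φ.toLinearMap.comp B.subtype.toLinearMap) where
  map_one := hφ.map_one
  re_nonneg a := by
    obtain ⟨r, hr, h⟩ := hφ.nonneg (a : G.Alg)
    change 0 ≤ (φ (star (a : G.Alg) * a)).re
    rw [h]
    exact hr
  im_eq_zero a := by
    obtain ⟨r, hr, h⟩ := hφ.nonneg (a : G.Alg)
    change (φ (star (a : G.Alg) * a)).im = 0
    rw [h]
    rfl
  tracial a b := by
    change φ ((a : G.Alg) * b) = φ ((b : G.Alg) * a)
    have hcl : IsClosed {x : G.Alg | φ (x * b) = φ ((b : G.Alg) * x)} :=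
      isClosed_eq (φ.continuous.comp (continuous_id.mul continuous_const))
        (φ.continuous.comp (continuous_const.mul continuous_id))
    refine hcl.closure_subset_iff.2 (fun x hx => ?_) (hB a a.2)
    change φ (x * b) = φ ((b : G.Alg) * x)
    induction hx using Submodule.span_induction with
    | mem x hx => obtain ⟨u, v, hp, rfl⟩ := hx; exact h u v hp b
    | zero => simp
    | add x y _ _ h1 h2 => rw [add_mul, mul_add, map_add, map_add, h1, h2]
    | smul c x _ h => rw [smul_mul_assoc, mul_smul_comm, map_smul, map_smul, h]

end TracialStates

/-! ### The scaling relation of `ω` on monomials. -/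

section KMSRelation

variable {G}

/-- The values of `ω = τ ∘ Φ₀` on the monomials. -/
structure IsGaugeTrace (ω : G.Alg →L[ℂ] ℂ) : Prop where
  map_self : ∀ u, ω (G.mono u u) = ((G.weight (G.d u))⁻¹ : ℂ)
  map_of_ne : ∀ u v, u ≠ v → ω (G.mono u v) = 0

namespace IsGaugeTrace

variable {ω : G.Alg →L[ℂ] ℂ}

/-- If the second word of a monomial begins with an edge `f` of colour `i`, both sides vanish for `f
≠ e`, while for `f = e` the lengths of the words account for the factor `m_i`. Every monomial is a
sum of such monomials. -/
lemma s_edge_mul (hω : IsGaugeTrace ω) (i : Fin k) (e : G.Edge i) (b : G.Alg) :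
    ω (G.s e * b) = ((G.m i : ℝ) : ℂ)⁻¹ * ω (b * G.s e) := by
  have key : ∀ x f y : Λ, G.d f = Pi.single i 1 →
      ω (G.s e * G.mono x (f * y)) = ((G.m i : ℝ) : ℂ)⁻¹ * ω (G.mono x (f * y) * G.s e) := by
    intro x f y hf
    rw [s_mul_mono]
    by_cases h : f = e
    · subst h
      have : G.mono x (e * y) * G.s e = G.mono x y := by
        rw [mono, mul_assoc, G.s_isCuntzType.star_mul_mul', mono]
      rw [this]
      by_cases hxy : x = y
      · subst hxy
        rw [hω.map_self, hω.map_self, G.d_mul, e.2, weight_add, weight_single]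
        push_cast
        rw [mul_inv]
      · rw [hω.map_of_ne _ _ hxy, hω.map_of_ne _ _ fun h => hxy (G.mul_left_cancel' h), mul_zero]
    · have : G.mono x (f * y) * G.s e = 0 := by
        rw [mono, map_mul G.s f, star_mul, mul_assoc, mul_assoc,
          G.s_isCuntzType.star_mul_of_ne_word (hf.trans e.2.symm) h, mul_zero, mul_zero]
      rw [this, map_zero, mul_zero, hω.map_of_ne]
      intro h'
      exact h (G.eq_and_eq_of_mul_eq_mul h' (e.2.trans hf.symm)).1.symm
  have h : ω.comp (ContinuousLinearMap.mul ℂ G.Alg (G.s e)) = ((G.m i : ℝ) : ℂ)⁻¹ •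
      ω.comp ((ContinuousLinearMap.mul ℂ G.Alg).flip (G.s e)) := by
    refine G.clm_ext fun x y => ?_
    change ω (G.s e * G.mono x y) = ((G.m i : ℝ) : ℂ)⁻¹ * ω (G.mono x y * G.s e)
    rw [G.mono_eq_sum x y (Pi.single i 1), Finset.mul_sum, Finset.sum_mul, map_sum, map_sum,
      Finset.mul_sum]
    refine Finset.sum_congr rfl fun g _ => ?_
    obtain ⟨f, y', hfy, hf, -⟩ := G.exists_factor (w := y * (g : Λ)) (p := Pi.single i 1)
      (by rw [G.d_mul, g.2]; simp)
    rw [hfy]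
    exact key _ _ _ hf
  exact DFunLike.congr_fun h b

/-- Insert `1 = ∑ s_f s_f^*` on the left and move each `s_f` to the right by `s_edge_mul`; only `f =
e` survives. -/
lemma mul_star_s_edge (hω : IsGaugeTrace ω) (i : Fin k) (e : G.Edge i) (b : G.Alg) :
    ω (b * star (G.s e)) = ((G.m i : ℝ) : ℂ)⁻¹ * ω (star (G.s e) * b) := by
  calc ω (b * star (G.s e)) = ∑ f : G.Edge i, ω (G.s f * (star (G.s f) * (b * star (G.s e)))) := by
        rw [← map_sum]
        simp only [← mul_assoc]
        rw [← Finset.sum_mul, ← Finset.sum_mul, G.s_isCuntzType.sum_mul_star, one_mul]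
    _ = ∑ f : G.Edge i, ((G.m i : ℝ) : ℂ)⁻¹ * ω (star (G.s f) * b * (star (G.s e) * G.s f)) := by
        refine Finset.sum_congr rfl fun f _ => ?_
        rw [hω.s_edge_mul]
        simp only [mul_assoc]
    _ = _ := by
        rw [Finset.sum_eq_single e]
        · rw [G.s_isCuntzType.star_mul_self, mul_one]
        · intro f _ hf
          rw [G.s_isCuntzType.star_mul_of_ne i e f hf.symm, mul_zero, map_zero, mul_zero]
        · simp

lemma s_mul (hω : IsGaugeTrace ω) (w : Λ) (b : G.Alg) :
    ω (G.s w * b) = (G.weight (G.d w) : ℂ)⁻¹ * ω (b * G.s w) := by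
  induction w using G.edge_induction generalizing b with
  | h1 => simp [G.d_one]
  | hmul i e w ih =>
    rw [map_mul G.s, mul_assoc, hω.s_edge_mul, mul_assoc, ih, G.d_mul, e.2, weight_add, weight_single]
    push_cast
    rw [mul_inv]
    simp only [mul_assoc]

lemma mul_star_s (hω : IsGaugeTrace ω) (w : Λ) (b : G.Alg) :
    ω (b * star (G.s w)) = (G.weight (G.d w) : ℂ)⁻¹ * ω (star (G.s w) * b) := by
  induction w using G.edge_induction generalizing b with
  | h1 => simp [G.d_one]
  | hmul i e w ih =>
    rw [map_mul G.s, star_mul, ← mul_assoc, hω.mul_star_s_edge, ← mul_assoc, ih, G.d_mul, e.2,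
      weight_add, weight_single]
    push_cast
    rw [mul_inv]
    simp only [mul_assoc]

/-- Used twice: the factor is the boundary shift in the KMS condition, and it is `1` for monomials
fixed by the flow, which places them in the centralizer of `ω`. -/
lemma mono_mul (hm : ∀ i, 1 < G.m i) (hω : IsGaugeTrace ω) (u v : Λ) (b : G.Alg) :
    ω (G.mono u v * b) =
      (G.weight (G.d v) / G.weight (G.d u) : ℂ) * ω (b * G.mono u v) := by
  have hv : (G.weight (G.d v) : ℂ) ≠ 0 := by exact_mod_cast (G.weight_pos hm _).ne'
  rw [mono, mul_assoc, hω.s_mul, ← mul_assoc b, hω.mul_star_s, mul_assoc (star (G.s v))]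
  field_simp

end IsGaugeTrace

lemma isGaugeTrace_comp_expectation {L : G.Alg →L[ℂ] ℂ}
    (hL : IsTracialState (L.toLinearMap.comp G.core.subtype.toLinearMap)) :
    IsGaugeTrace (L.comp G.expectationL) where
  map_self u := by
    change L (G.expectation _) = _
    rw [G.expectation_of_mem_core (G.mono_mem_core rfl)]
    exact hL.map_mono_self le_rfl u (G.mono_mem_core rfl)
  map_of_ne u v h := by
    change L (G.expectation _) = _
    by_cases hd : G.d u = G.d v
    · rw [G.expectation_of_mem_core (G.mono_mem_core hd)]
      exact hL.map_mono_of_ne le_rfl hd h (G.mono_mem_core hd)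
    · rw [G.expectation_mono_of_ne hd, map_zero]

end KMSRelation

/-! ### Bounded analytic functions on the strip. -/

section Strip

open Filter Topology

/-- The three lines bound for bounded functions on the strip `0 ≤ Im z ≤ 1`. -/
lemma norm_le_on_strip {F : ℂ → ℂ} (hF : DiffContOnCl ℂ F {z | 0 < z.im ∧ z.im < 1})
    (hb : ∃ C : ℝ, ∀ z : ℂ, 0 ≤ z.im → z.im ≤ 1 → ‖F z‖ ≤ C) {D : ℝ}
    (h0 : ∀ t : ℝ, ‖F t‖ ≤ D) (h1 : ∀ t : ℝ, ‖F (t + Complex.I)‖ ≤ D) {z : ℂ} (hz0 : 0 ≤ z.im)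
    (hz1 : z.im ≤ 1) : ‖F z‖ ≤ D := by
  obtain ⟨C, hC⟩ := hb
  -- For a bounded function both growth constants may be zero.
  refine PhragmenLindelof.horizontal_strip (a := 0) (b := 1) hF ⟨0, ?_, 0, ?_⟩ ?_ ?_ hz0 hz1
  · simpa using Real.pi_pos
  · refine Asymptotics.IsBigO.of_bound C ?_
    rw [eventually_inf_principal]
    refine Eventually.of_forall fun w hw => ?_
    simpa using hC w hw.1.le hw.2.le
  · intro w hw
    have : w = (w.re : ℂ) := Complex.ext rfl (by simpa using hw)
    rw [this]
    exact h0 _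
  · intro w hw
    have : w = (w.re : ℂ) + Complex.I := Complex.ext (by simp) (by simpa using hw)
    rw [this]
    exact h1 _

/-- Bounded functions on the strip whose boundary values converge uniformly have a limit. -/
lemma exists_limit_on_strip {F : ℕ → ℂ → ℂ}
    (hF : ∀ n, DiffContOnCl ℂ (F n) {z | 0 < z.im ∧ z.im < 1})
    (hb : ∀ n, ∃ C : ℝ, ∀ z : ℂ, 0 ≤ z.im → z.im ≤ 1 → ‖F n z‖ ≤ C)
    (hc : ∀ ε > 0, ∃ N, ∀ m ≥ N, ∀ n ≥ N, ∀ t : ℝ, ‖F m t - F n t‖ ≤ ε ∧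
      ‖F m (t + Complex.I) - F n (t + Complex.I)‖ ≤ ε) :
    ∃ f : ℂ → ℂ, DiffContOnCl ℂ f {z | 0 < z.im ∧ z.im < 1} ∧
      ∀ z : ℂ, 0 ≤ z.im → z.im ≤ 1 → Tendsto (fun n => F n z) atTop (𝓝 (f z)) := by
  have hu : UniformCauchySeqOn F atTop {z : ℂ | 0 ≤ z.im ∧ z.im ≤ 1} := by
    rw [Metric.uniformCauchySeqOn_iff]
    intro ε hε
    obtain ⟨N, hN⟩ := hc (ε / 2) (half_pos hε)
    refine ⟨N, fun m hm n hn z hz => ?_⟩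
    rw [dist_eq_norm]
    refine lt_of_le_of_lt ?_ (half_lt_self hε)
    refine norm_le_on_strip (F := fun z => F m z - F n z) ((hF m).sub (hF n)) ?_
      (fun t => (hN m hm n hn t).1) (fun t => (hN m hm n hn t).2) hz.1 hz.2
    obtain ⟨C, hC⟩ := hb m
    obtain ⟨C', hC'⟩ := hb n
    exact ⟨C + C', fun w h0 h1 => (norm_sub_le _ _).trans (add_le_add (hC w h0 h1) (hC' w h0 h1))⟩
  have hlim : ∀ z : ℂ, ∃ y, z ∈ {z : ℂ | 0 ≤ z.im ∧ z.im ≤ 1} →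
      Tendsto (fun n => F n z) atTop (𝓝 y) := by
    intro z
    by_cases hz : z ∈ {z : ℂ | 0 ≤ z.im ∧ z.im ≤ 1}
    · obtain ⟨y, hy⟩ := cauchySeq_tendsto_of_complete (hu.cauchySeq hz)
      exact ⟨y, fun _ => hy⟩
    · exact ⟨0, fun h => absurd h hz⟩
  choose f hf using hlim
  have hunif := hu.tendstoUniformlyOn_of_tendsto hf
  have hclos : closure {z : ℂ | 0 < z.im ∧ z.im < 1} = {z : ℂ | 0 ≤ z.im ∧ z.im ≤ 1} := by
    have := Complex.closure_preimage_im (Set.Ioo 0 1)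
    rw [closure_Ioo zero_ne_one] at this
    exact this
  have hopen : IsOpen {z : ℂ | 0 < z.im ∧ z.im < 1} :=
    (isOpen_lt continuous_const Complex.continuous_im).inter
      (isOpen_lt Complex.continuous_im continuous_const)
  refine ⟨f, ⟨?_, ?_⟩, fun z h0 h1 => hf z ⟨h0, h1⟩⟩
  · refine TendstoLocallyUniformlyOn.differentiableOn (F := F) (φ := atTop)
      ((hunif.mono fun z hz => ⟨hz.1.le, hz.2.le⟩).tendstoLocallyUniformlyOn)
      (Eventually.of_forall fun n => (hF n).differentiableOn) hopen
  · rw [hclos]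
    refine hunif.continuousOn (Frequently.of_forall fun n => ?_)
    rw [← hclos]
    exact (hF n).continuousOn

end Strip

/-! ### The modular condition. -/

section ModularGroup

variable {G}

/-- The KMS condition for the pair `a`, `b`. -/
def KMSPair (ω : G.Alg →L[ℂ] ℂ) (a b : G.Alg) : Prop :=
  ∃ F : ℂ → ℂ, DiffContOnCl ℂ F {z | 0 < z.im ∧ z.im < 1} ∧
    (∃ C : ℝ, ∀ z : ℂ, 0 ≤ z.im → z.im ≤ 1 → ‖F z‖ ≤ C) ∧
    ∀ t : ℝ, F t = ω (G.modularFlow t a * b) ∧ F (t + Complex.I) = ω (b * G.modularFlow t a)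

lemma norm_modularFlow (t : ℝ) (a : G.Alg) : ‖G.modularFlow t a‖ = ‖a‖ := G.norm_gauge _ a

/-- The flow multiplies the monomial by `exp(itl)`, so `exp(izl)` is the analytic continuation. At
`z = t + i` it gains `e^{-l} = m^{d(u)-d(v)}`, which cancels the factor in `IsGaugeTrace.mono_mul`.
-/
lemma kmsPair_mono (hm : ∀ i, 1 < G.m i) {ω : G.Alg →L[ℂ] ℂ} (hω : IsGaugeTrace ω) (u v : Λ)
    (b : G.Alg) : KMSPair ω (G.mono u v) b := by
  set l : ℝ := Real.log (G.weight (G.d v)) - Real.log (G.weight (G.d u)) with hl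
  refine ⟨fun z => Complex.exp (z * l * Complex.I) * ω (G.mono u v * b), ?_, ?_, fun t => ⟨?_, ?_⟩⟩
  · exact Differentiable.diffContOnCl (by fun_prop)
  · refine ⟨Real.exp |l| * ‖ω (G.mono u v * b)‖, fun z h0 h1 => ?_⟩
    rw [norm_mul, Complex.norm_exp]
    refine mul_le_mul_of_nonneg_right (Real.exp_le_exp.2 ?_) (norm_nonneg _)
    have : (z * l * Complex.I).re = -(z.im * l) := by simp
    rw [this, ← mul_neg]
    calc z.im * -l ≤ z.im * |l| := mul_le_mul_of_nonneg_left (neg_le_abs l) h0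
      _ ≤ 1 * |l| := mul_le_mul_of_nonneg_right h1 (abs_nonneg l)
      _ = |l| := one_mul _
  · rw [modularFlow_mono hm, smul_mul_assoc, map_smul, Circle.coe_exp, smul_eq_mul, ← hl,
      Complex.ofReal_mul]
  · have hu := G.weight_pos hm (G.d u)
    have hv := G.weight_pos hm (G.d v)
    have hu' : (G.weight (G.d u) : ℂ) ≠ 0 := by exact_mod_cast hu.ne'
    have hv' : (G.weight (G.d v) : ℂ) ≠ 0 := by exact_mod_cast hv.ne'
    have he : Complex.exp (-l) = G.weight (G.d u) / G.weight (G.d v) := by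
      rw [← Complex.ofReal_neg, ← Complex.ofReal_exp, hl, neg_sub, Real.exp_sub, Real.exp_log hu,
        Real.exp_log hv, Complex.ofReal_div]
    have he' : ((t : ℂ) + Complex.I) * l * Complex.I = (t * l : ℝ) * Complex.I + -l := by
      have := Complex.I_mul_I
      push_cast
      linear_combination (l : ℂ) * this
    dsimp only
    rw [modularFlow_mono hm, mul_smul_comm, map_smul, Circle.coe_exp, smul_eq_mul, ← hl, he',
      Complex.exp_add, he, hω.mono_mul hm]
    field_simp

lemma kmsPair_add {ω : G.Alg →L[ℂ] ℂ} {a a' b : G.Alg} (h : KMSPair ω a b)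
    (h' : KMSPair ω a' b) : KMSPair ω (a + a') b := by
  obtain ⟨F, h1, ⟨C, hC⟩, h3⟩ := h
  obtain ⟨F', h1', ⟨C', hC'⟩, h3'⟩ := h'
  refine ⟨fun z => F z + F' z, h1.add h1', ⟨C + C', fun z h0 h1 =>
    (norm_add_le _ _).trans (add_le_add (hC z h0 h1) (hC' z h0 h1))⟩, fun t => ⟨?_, ?_⟩⟩
  · dsimp only; rw [(h3 t).1, (h3' t).1, map_add, add_mul, map_add]
  · dsimp only; rw [(h3 t).2, (h3' t).2, map_add, mul_add, map_add]

lemma kmsPair_smul {ω : G.Alg →L[ℂ] ℂ} {a b : G.Alg} (c : ℂ) (h : KMSPair ω a b) :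
    KMSPair ω (c • a) b := by
  obtain ⟨F, h1, ⟨C, hC⟩, h3⟩ := h
  refine ⟨fun z => c • F z, h1.const_smul c, ⟨‖c‖ * C, fun z h0 h1 => ?_⟩, fun t => ⟨?_, ?_⟩⟩
  · rw [norm_smul]
    exact mul_le_mul_of_nonneg_left (hC z h0 h1) (norm_nonneg _)
  · dsimp only; rw [(h3 t).1, map_smul, smul_mul_assoc, map_smul]
  · dsimp only; rw [(h3 t).2, map_smul, mul_smul_comm, map_smul]

/-- Approximate `a` by combinations `x n` of monomials. The boundary values for `x m` and `x n`
differ by at most `‖x m - x n‖ ‖b‖`, uniformly in time, so the functions converge uniformly on the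
strip. -/
lemma kmsPair_of_isGaugeTrace (hm : ∀ i, 1 < G.m i) {ω : G.Alg →L[ℂ] ℂ} (hω : IsGaugeTrace ω)
    (hn : ∀ a, ‖ω a‖ ≤ ‖a‖) (a b : G.Alg) : KMSPair ω a b := by
  have hspan : ∀ x ∈ Submodule.span ℂ (Set.range fun x : Λ × Λ => G.mono x.1 x.2),
      KMSPair ω x b := by
    intro x hx
    induction hx using Submodule.span_induction with
    | mem x hx => obtain ⟨y, rfl⟩ := hx; exact kmsPair_mono hm hω _ _ b
    | zero => simpa using kmsPair_smul 0 (kmsPair_mono hm hω 1 1 b)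
    | add x y _ _ h1 h2 => exact kmsPair_add h1 h2
    | smul c x _ h => exact kmsPair_smul c h
  obtain ⟨x, hx, hlim⟩ := mem_closure_iff_seq_limit.1 (G.dense_span_mono a)
  choose F h1 h2 h3 using fun n => hspan (x n) (hx n)
  have hbd : ∀ y c : G.Alg, ‖ω (y * c)‖ ≤ ‖y‖ * ‖c‖ := fun y c => (hn _).trans (norm_mul_le _ _)
  obtain ⟨f, hf, hft⟩ := exists_limit_on_strip h1 h2 <| by
    intro ε hε
    obtain ⟨N, hN⟩ := Metric.cauchySeq_iff.1 hlim.cauchySeq (ε / (‖b‖ + 1)) (by positivity)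
    refine ⟨N, fun m hm n hn t => ?_⟩
    have hd : ‖x m - x n‖ * ‖b‖ ≤ ε := by
      have := hN m hm n hn
      rw [dist_eq_norm] at this
      calc ‖x m - x n‖ * ‖b‖ ≤ ε / (‖b‖ + 1) * (‖b‖ + 1) := by
            gcongr; linarith
        _ = ε := div_mul_cancel₀ _ (by positivity)
    constructor
    · rw [(h3 m t).1, (h3 n t).1, ← map_sub, ← sub_mul, ← map_sub]
      refine (hbd _ _).trans ?_
      rwa [norm_modularFlow]
    · rw [(h3 m t).2, (h3 n t).2, ← map_sub, ← mul_sub, ← map_sub]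
      refine (hbd _ _).trans ?_
      rwa [norm_modularFlow, mul_comm]
  have hflow : ∀ t : ℝ, Filter.Tendsto (fun n => G.modularFlow t (x n)) Filter.atTop
      (nhds (G.modularFlow t a)) := fun t =>
    ((isometry_starAlgEquiv (G.modularFlow t)).continuous.tendsto a).comp hlim
  have hf0 : ∀ t : ℝ, f t = ω (G.modularFlow t a * b) := fun t => by
    refine tendsto_nhds_unique (hft t (by simp) (by simp)) ?_
    simp only [fun n => (h3 n t).1]
    exact (ω.continuous.tendsto _).comp ((hflow t).mul_const b)
  have hf1 : ∀ t : ℝ, f (t + Complex.I) = ω (b * G.modularFlow t a) := fun t => by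
    refine tendsto_nhds_unique (hft _ (by simp) (by simp)) ?_
    simp only [fun n => (h3 n t).2]
    exact (ω.continuous.tendsto _).comp ((hflow t).const_mul b)
  refine ⟨f, hf, ?_, fun t => ⟨hf0 t, hf1 t⟩⟩
  obtain ⟨M, hM⟩ := (Metric.isBounded_range_of_tendsto x hlim).exists_norm_le
  refine ⟨M * ‖b‖, fun z hz0 hz1 => le_of_tendsto (hft z hz0 hz1).norm
    (Filter.Eventually.of_forall fun n => ?_)⟩
  have hxn : ‖x n‖ ≤ M := hM _ ⟨n, rfl⟩
  refine norm_le_on_strip (h1 n) (h2 n) (fun t => ?_) (fun t => ?_) hz0 hz1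
  · rw [(h3 n t).1]
    refine (hbd _ _).trans ?_
    rw [norm_modularFlow]
    gcongr
  · rw [(h3 n t).2]
    refine (hbd _ _).trans ?_
    rw [norm_modularFlow, mul_comm]
    gcongr

lemma isModularGroup_of_isGaugeTrace (hm : ∀ i, 1 < G.m i) {ω : G.Alg →L[ℂ] ℂ}
    (hω : IsGaugeTrace ω) (hn : ∀ a, ‖ω a‖ ≤ ‖a‖)
    (hinv : ∀ t a, ω (G.gauge t a) = ω a) : IsModularGroup ω G.modularFlow where
  map_zero a := by
    have : (fun i => Circle.exp (-(0 * Real.log (G.m i)))) = (1 : Fin k → Circle) := by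
      funext i; simp
    rw [modularFlow, this]
    exact DFunLike.congr_fun G.gaugeHom_one a
  map_add t u a := by
    rw [modularFlow, modularFlow, modularFlow, gauge_gauge]
    congr 2
    funext i
    rw [Pi.mul_apply, ← Circle.exp_add]
    congr 1
    ring
  continuous a := (G.continuous_gauge a).comp (by fun_prop)
  invariant t a := hinv _ a
  kms a b := kmsPair_of_isGaugeTrace hm hω hn a b

end ModularGroup

/-! ### Common extensions under the little pull-back property. -/

section LittlePullback

variable {G}

lemma LittlePullback.edge_edge (hG : G.LittlePullback) {i j : Fin k} (hij : i ≠ j)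
    {e x x' f y y' : Λ} (he : G.d e = Pi.single i 1) (hf : G.d f = Pi.single j 1)
    (h : e * x = f * y) (h' : e * x' = f * y') (hx : G.d x = Pi.single j 1)
    (hx' : G.d x' = Pi.single j 1) : x = x' := by
  have hsup : (Pi.single i 1 + Pi.single j 1 : Fin k → ℕ) = Pi.single i 1 ⊔ Pi.single j 1 := by
    funext l
    by_cases hi : l = i
    · subst hi; simp [hij]
    · simp [hi]
  have := Set.encard_le_one_iff.1 (hG i j hij ⟨e, he⟩ ⟨f, hf⟩) (x, y) (x', y')
    ⟨h, by rw [G.d_mul, he, hx, hf, hsup]⟩ ⟨h', by rw [G.d_mul, he, hx', hf, hsup]⟩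
  exact congrArg Prod.fst this

/-- Commute `e` past the first edge of `v`; the result is unique and leaves a determined edge of the
same colour to be commuted past the rest of `v`. -/
lemma LittlePullback.edge_word (hG : G.LittlePullback) {i : Fin k} (v : Λ) (hv : G.d v i = 0)
    {e x x' y y' : Λ} (he : G.d e = Pi.single i 1) (h : e * x = v * y) (h' : e * x' = v * y')
    (hx : G.d x = G.d v) (hx' : G.d x' = G.d v) : x = x' := by
  induction v using G.edge_induction generalizing e x x' y y' with
  | h1 =>
    rw [G.d_one] at hx hx'
    rw [G.eq_one_of_d_eq_zero hx, G.eq_one_of_d_eq_zero hx']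
  | hmul j f w ih =>
    rw [G.d_mul, f.2] at hv hx hx'
    have hij : i ≠ j := by
      rintro rfl
      simp at hv
    have key : ∀ x y, e * x = f * w * y → G.d x = Pi.single j 1 + G.d w →
        ∃ x₁ g z, x = x₁ * z ∧ e * x₁ = f * g ∧ w * y = g * z ∧ G.d x₁ = Pi.single j 1 ∧
          G.d g = Pi.single i 1 ∧ G.d z = G.d w := by
      intro x y h hx
      have hdy : G.d y = Pi.single i 1 := by
        have := congrArg G.d h
        rw [G.d_mul, G.d_mul, G.d_mul, he, f.2, hx, add_comm] at this
        exact (add_left_cancel this).symm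
      obtain ⟨x₁, x₂, rfl, hx₁, hx₂⟩ := G.exists_factor (w := x) (p := Pi.single j 1) (by simp [hx])
      obtain ⟨g, z, hgz, hg, -⟩ := G.exists_factor (w := w * y) (p := Pi.single i 1)
        (by rw [G.d_mul, hdy]; simp)
      rw [mul_assoc, hgz, ← mul_assoc, ← mul_assoc] at h
      obtain ⟨h1, h2⟩ := G.eq_and_eq_of_mul_eq_mul h
        (by rw [G.d_mul, G.d_mul, he, hx₁, f.2, hg, add_comm])
      subst h2
      refine ⟨x₁, g, x₂, rfl, h1, hgz, hx₁, hg, ?_⟩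
      rw [hx₂, hx, add_tsub_cancel_left]
    obtain ⟨x₁, g, z, rfl, h1, h2, hx₁, hg, hz⟩ := key x y h hx
    obtain ⟨x₁', g', z', rfl, h1', h2', hx₁', hg', hz'⟩ := key x' y' h' hx'
    obtain rfl := hG.edge_edge hij he f.2 h1 h1' hx₁ hx₁'
    obtain rfl := G.mul_left_cancel' (h1.symm.trans h1')
    have hw : G.d w i = 0 := by
      rw [Pi.add_apply] at hv
      exact (Nat.add_eq_zero_iff.1 hv).2
    rw [ih hw hg h2.symm h2'.symm hz hz']

/-- With the little pull-back property, words with disjoint colours have at most one minimal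
common extension. -/
lemma LittlePullback.word_word (hG : G.LittlePullback) (u : Λ) {v : Λ}
    (huv : ∀ i, G.d u i = 0 ∨ G.d v i = 0) {x x' y y' : Λ} (h : u * x = v * y)
    (h' : u * x' = v * y') (hx : G.d x = G.d v) (hx' : G.d x' = G.d v) : x = x' := by
  induction u using G.edge_induction generalizing v x x' y y' with
  | h1 =>
    rw [one_mul] at h h'
    have h1 := (G.eq_and_eq_of_mul_eq_mul (a := x) (b := 1) (by rw [mul_one, h]) hx).1
    have h2 := (G.eq_and_eq_of_mul_eq_mul (a := x') (b := 1) (by rw [mul_one, h']) hx').1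
    rw [h1, h2]
  | hmul i e w ih =>
    have hvi : G.d v i = 0 := by
      refine (huv i).resolve_left ?_
      rw [G.d_mul, e.2]
      simp
    -- The square for `e w` and `v` splits into one for `e` and `v`, with solution `z` fixed by
    -- `edge_word`, and one for `w` and `z`, covered by induction.
    have key : ∀ x y, e * w * x = v * y → G.d x = G.d v →
        ∃ z t y₁, e * z = v * y₁ ∧ w * x = z * t ∧ G.d z = G.d v := by
      intro x y h hx
      have hdy : G.d y = Pi.single i 1 + G.d w := by
        have := congrArg G.d h
        rw [G.d_mul, G.d_mul, G.d_mul, hx, e.2, add_comm] at this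
        exact (add_left_cancel this).symm
      obtain ⟨y₁, y₂, rfl, hy₁, -⟩ := G.exists_factor (w := y) (p := Pi.single i 1) (by simp [hdy])
      obtain ⟨z, t, hzt, hz, -⟩ := G.exists_factor (w := w * x) (p := G.d v)
        (by rw [G.d_mul, hx]; simp)
      rw [mul_assoc, hzt, ← mul_assoc, ← mul_assoc] at h
      refine ⟨z, t, y₁, (G.eq_and_eq_of_mul_eq_mul h ?_).1, hzt, hz⟩
      rw [G.d_mul, G.d_mul, e.2, hz, hy₁, add_comm]
    obtain ⟨z, t, y₁, h1, h2, hz⟩ := key x y h hx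
    obtain ⟨z', t', y₁', h1', h2', hz'⟩ := key x' y' h' hx'
    obtain rfl := hG.edge_word v hvi e.2 h1 h1' hz hz'
    refine ih (fun j => ?_) h2 h2' (hx.trans hz.symm) (hx'.trans hz.symm)
    rw [hz]
    refine (huv j).imp_left fun h => ?_
    rw [G.d_mul, Pi.add_apply] at h
    exact (Nat.add_eq_zero_iff.1 h).2

/-- At most one word `α` of degree `n d(u)` is such that `v α` and `u α` have a common
extension. -/
lemma LittlePullback.eq_of_common_extension (hG : G.LittlePullback) (n : ℕ) {u v α α' : Λ}
    (huv : ∀ i, G.d u i = 0 ∨ G.d v i = 0) (hα : G.d α = n • G.d u) (hα' : G.d α' = n • G.d u)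
    (h : ∃ y z, v * α * y = u * α * z) (h' : ∃ y z, v * α' * y = u * α' * z) : α = α' := by
  induction n generalizing u v α α' with
  | zero =>
    rw [zero_smul] at hα hα'
    rw [G.eq_one_of_d_eq_zero hα, G.eq_one_of_d_eq_zero hα']
  | succ n ih =>
    -- Peel off the first block `a` of `α`, of degree `d(u)`. Comparing prefixes gives `u c = v a`,
    -- so `word_word` determines `c` and cancellation determines `a`; the rest `β` solves the same
    -- problem for the pair `(a, c)`, whose degrees are those of `(u, v)`.
    have key : ∀ α, G.d α = (n + 1) • G.d u → (∃ y z, v * α * y = u * α * z) →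
        ∃ a β c, α = a * β ∧ G.d a = G.d u ∧ G.d c = G.d v ∧ G.d β = n • G.d u ∧ u * c = v * a ∧
          ∃ y z, c * β * y = a * β * z := by
      rintro α hα ⟨y, z, h⟩
      obtain ⟨a, β, rfl, ha, hβ⟩ := G.exists_factor (w := α) (p := G.d u)
        (by rw [hα, succ_nsmul]; simp)
      -- The common extension gives `d(v) + d(y) = d(u) + d(z)`; where `d(v)` is nonzero `d(u)`
      -- vanishes, so `d(z)` already dominates `d(v)` there.
      have hle : G.d v ≤ G.d (a * β * z) := by
        intro i
        have := congrFun (congrArg G.d h) i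
        simp only [G.d_mul, Pi.add_apply] at this ⊢
        rcases huv i with hi | hi <;> omega
      obtain ⟨c, t, hct, hc, -⟩ := G.exists_factor hle
      have h2 : v * a * (β * y) = u * c * t := by
        rw [mul_assoc u c, ← hct]
        simpa only [mul_assoc] using h
      obtain ⟨h3, rfl⟩ := G.eq_and_eq_of_mul_eq_mul h2
        (by rw [G.d_mul, G.d_mul, ha, hc, add_comm])
      refine ⟨a, β, c, rfl, ha, hc, ?_, h3.symm, y, z, ?_⟩
      · rw [hβ, hα, succ_nsmul, add_tsub_cancel_right]
      · rw [hct, mul_assoc]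
    obtain ⟨a, β, c, rfl, ha, hc, hβ, h1, h2⟩ := key α hα h
    obtain ⟨a', β', c', rfl, ha', hc', hβ', h1', h2'⟩ := key α' hα' h'
    obtain rfl := hG.word_word u huv h1 h1' hc hc'
    obtain rfl := G.mul_left_cancel' (h1.symm.trans h1')
    rw [ih (u := a) (v := c) (by rwa [ha, hc]) (by rw [hβ, ha]) (by rw [hβ', ha]) h2 h2']

end LittlePullback

/-! ### Compressed traces and vanishing off degree zero. -/

section Compression

lemma character_smul_star (t : Fin k → Circle) (w : Λ) (a : G.Alg) :
    (G.character t w : ℂ) • star (G.character t w : ℂ) • a = a := by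
  rw [smul_smul]
  have : (G.character t w : ℂ) * star (G.character t w : ℂ) = 1 := by
    rw [Complex.star_def, ← Circle.coe_inv_eq_conj, ← Circle.coe_mul, mul_inv_cancel,
      Circle.coe_one]
  rw [this, one_smul]

lemma gauge_conj (t : Fin k → Circle) (w : Λ) (a : G.Alg) :
    G.gauge t (G.s w * a * star (G.s w)) = G.s w * G.gauge t a * star (G.s w) := by
  rw [map_mul, map_mul, map_star, gauge_s, star_smul, smul_mul_assoc, smul_mul_smul_comm,
    ← smul_smul, character_smul_star]

lemma gauge_conj_star (t : Fin k → Circle) (w : Λ) (a : G.Alg) :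
    G.gauge t (star (G.s w) * a * G.s w) = star (G.s w) * G.gauge t a * G.s w := by
  rw [map_mul, map_mul, map_star, gauge_s, star_smul, smul_mul_assoc, smul_mul_smul_comm,
    mul_comm, ← smul_smul, character_smul_star]

variable {G}

lemma conj_mem_modularFixed {a : G.Alg} (ha : a ∈ G.modularFixed) (w : Λ) :
    G.s w * a * star (G.s w) ∈ G.modularFixed := fun t => by
  rw [modularFlow, gauge_conj, ← modularFlow, ha t]

lemma conj_star_mem_modularFixed {a : G.Alg} (ha : a ∈ G.modularFixed) (w : Λ) :
    star (G.s w) * a * G.s w ∈ G.modularFixed := fun t => by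
  rw [modularFlow, gauge_conj_star, ← modularFlow, ha t]

/-- The functional `a ↦ m^{d(w)} φ(s_w a s_w^*)`. -/
noncomputable def compression (φ : G.modularFixed →ₗ[ℂ] ℂ) (w : Λ) :
    G.modularFixed →ₗ[ℂ] ℂ where
  toFun a := (G.weight (G.d w) : ℂ) *
    φ ⟨G.s w * a * star (G.s w), conj_mem_modularFixed a.2 w⟩
  map_add' a b := by
    rw [← mul_add, ← map_add]
    congr 2
    exact Subtype.ext (by simp [mul_add, add_mul])
  map_smul' c a := by
    rw [RingHom.id_apply, smul_eq_mul, mul_left_comm, ← smul_eq_mul c, ← map_smul]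
    congr 2
    exact Subtype.ext (by simp)

/-- Conjugation `a ↦ s_w a s_w^*` is multiplicative and star-preserving, and it sends `1` to a
projection of trace `m^{-d(w)}`; hence the normalizing factor. -/
lemma IsTracialState.compression (hm : ∀ i, 1 < G.m i) {φ : G.modularFixed →ₗ[ℂ] ℂ}
    (hφ : IsTracialState φ) (w : Λ) :
    IsTracialState (SingleVertexKGraph.compression φ w) := by
  have hw := G.weight_pos hm (G.d w)
  let c : G.modularFixed → G.modularFixed := fun a =>
    ⟨G.s w * a * star (G.s w), conj_mem_modularFixed a.2 w⟩
  have hc : ∀ a, SingleVertexKGraph.compression φ w a = (G.weight (G.d w) : ℂ) * φ (c a) :=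
    fun _ => rfl
  have hmul : ∀ a b, c (a * b) = c a * c b := fun a b => Subtype.ext <| by
    change G.s w * (a * b) * star (G.s w) =
      G.s w * a * star (G.s w) * (G.s w * b * star (G.s w))
    calc _ = G.s w * a * 1 * b * star (G.s w) := by simp only [mul_assoc, one_mul]
      _ = _ := by rw [← G.s_isCuntzType.isometry w]; simp only [mul_assoc]
  have hstar : ∀ a, c (star a) = star (c a) := fun a => Subtype.ext <| by
    change G.s w * star (a : G.Alg) * star (G.s w) = star (G.s w * a * star (G.s w))
    simp [mul_assoc]
  refine ⟨?_, fun a => ?_, fun a => ?_, fun a b => ?_⟩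
  · have h1 : c 1 = ⟨G.mono w w, G.core_le_modularFixed (G.mono_mem_core rfl)⟩ :=
      Subtype.ext (by change G.s w * 1 * star (G.s w) = _; rw [mul_one]; rfl)
    rw [hc, h1, hφ.map_mono_self G.core_le_modularFixed]
    exact mul_inv_cancel₀ (by exact_mod_cast hw.ne')
  · rw [hc, hmul, hstar, Complex.re_ofReal_mul]
    exact mul_nonneg hw.le (hφ.re_nonneg _)
  · rw [hc, hmul, hstar, Complex.im_ofReal_mul, hφ.im_eq_zero, mul_zero]
  · rw [hc, hc, hmul, hmul, hφ.tracial]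

/-- With `P_w = s_w s_w^*`, the trace property gives `φ(a) = ∑ φ(P_w a P_w)`, and `P_w a P_w` is the
conjugate by `s_w` of `s_w^* a s_w`. -/
lemma IsTracialState.eq_sum_compression (hm : ∀ i, 1 < G.m i) {φ : G.modularFixed →ₗ[ℂ] ℂ}
    (hφ : IsTracialState φ) (p : Fin k → ℕ) (a : G.modularFixed) :
    φ a = (G.weight p : ℂ)⁻¹ * ∑ w : G.Word p, SingleVertexKGraph.compression φ (w : Λ)
      ⟨star (G.s w) * a * G.s w, conj_star_mem_modularFixed a.2 w⟩ := by
  have hw : (G.weight p : ℂ) ≠ 0 := by exact_mod_cast (G.weight_pos hm p).ne'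
  let P : G.Word p → G.modularFixed := fun w =>
    ⟨G.mono (w : Λ) w, G.core_le_modularFixed (G.mono_mem_core rfl)⟩
  have hterm : ∀ w : G.Word p, φ (a * P w) = (G.weight p : ℂ)⁻¹ *
      SingleVertexKGraph.compression φ (w : Λ)
        ⟨star (G.s w) * a * G.s w, conj_star_mem_modularFixed a.2 w⟩ := by
    intro w
    have e1 : P w = P w * P w := Subtype.ext (G.mono_mul_mono _ _ _).symm
    have e2 : SingleVertexKGraph.compression φ (w : Λ)
        ⟨star (G.s w) * a * G.s w, conj_star_mem_modularFixed a.2 w⟩ =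
        (G.weight p : ℂ) * φ (P w * (a * P w)) := by
      have hwp : G.weight (G.d w) = G.weight p := by rw [w.2]
      rw [← hwp]
      change _ * φ _ = _ * φ _
      congr 2
      refine Subtype.ext ?_
      change G.s w * (star (G.s w) * (a : G.Alg) * G.s w) * star (G.s w) =
        G.s w * star (G.s w) * ((a : G.Alg) * (G.s w * star (G.s w)))
      simp only [mul_assoc]
    rw [e2, inv_mul_cancel_left₀ hw, hφ.tracial (P w), mul_assoc, ← e1]
  have hone : ∑ w : G.Word p, P w = 1 := Subtype.ext <| by
    rw [AddSubmonoidClass.coe_finsetSum]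
    exact G.sum_mono p
  rw [Finset.mul_sum, ← Finset.sum_congr rfl fun w _ => hterm w, ← map_sum, ← Finset.mul_sum,
    hone, mul_one]

lemma norm_star_s_mul_mono_mul_s_le (u v w : Λ) :
    ‖star (G.s w) * G.mono u v * G.s w‖ ≤ 1 := by
  have h : ∀ x y : G.Alg, ‖x‖ ≤ 1 → ‖y‖ ≤ 1 → ‖x * y‖ ≤ 1 := fun x y hx hy =>
    (norm_mul_le x y).trans (mul_le_one₀ hx (norm_nonneg y) hy)
  have h' : ∀ w, ‖star (G.s w)‖ ≤ 1 := fun w => (norm_star (G.s w)).trans_le (G.norm_s_le w)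
  exact h _ _ (h _ _ (h' w) (h _ _ (G.norm_s_le u) (h' v))) (G.norm_s_le w)

/-- Nonvanishing of `s_w^* s_u` forces `w = u α`. The product then becomes `s_{vα}^* s_{uα}`, and
its nonvanishing gives the common extension. -/
lemma exists_of_star_s_mul_mono_mul_s_ne_zero {n : ℕ} {u v w : Λ}
    (hw : G.d w = (n + 1) • G.d u) (h : star (G.s w) * G.mono u v * G.s w ≠ 0) :
    ∃ α, w = u * α ∧ G.d α = n • G.d u ∧ ∃ y z, v * α * y = u * α * z := by
  have h0 : star (G.s w) * G.s u * star (G.s v) * G.s w ≠ 0 := by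
    rwa [mul_assoc (star (G.s w))]
  obtain ⟨y, z, hyz⟩ := G.s_isCuntzType.exists_common_extension
    (a := w) (b := u) fun h => h0 (by rw [h, zero_mul, zero_mul])
  obtain ⟨u', α, rfl, hu', hdα⟩ := G.exists_factor (w := w) (p := G.d u)
    (by rw [hw, succ_nsmul]; simp)
  obtain rfl : u' = u := by
    rw [mul_assoc] at hyz
    exact (G.eq_and_eq_of_mul_eq_mul hyz hu').1
  refine ⟨α, rfl, ?_, ?_⟩
  · rw [hdα, hw, succ_nsmul, add_tsub_cancel_right]
  · refine G.s_isCuntzType.exists_common_extension fun h => h0 ?_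
    rw [G.s_isCuntzType.star_mul_mul', ← star_mul, ← map_mul, h]

/-- Under the little pull-back property, the monomials `s_u s_v^*` with `u`, `v` of disjoint
colours have trace zero. -/
lemma IsTracialState.map_mono_of_disjoint (hm : ∀ i, 1 < G.m i) (hG : G.LittlePullback)
    {φ : G.modularFixed →ₗ[ℂ] ℂ} (hφ : IsTracialState φ) {u v : Λ}
    (huv : ∀ i, G.d u i = 0 ∨ G.d v i = 0) (hu : G.d u ≠ 0) (h : G.mono u v ∈ G.modularFixed) :
    φ ⟨G.mono u v, h⟩ = 0 := by
  have := isClosed_modularFixed (G := G)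
  -- Of the `m^{(n+1) d(u)}` terms in the averaged formula at most one is nonzero, and it has
  -- modulus at most `1`.
  have hbound : ∀ n : ℕ, ‖φ ⟨G.mono u v, h⟩‖ ≤ ((G.weight (G.d u))⁻¹) ^ (n + 1) := by
    intro n
    have hw := G.weight_pos hm ((n + 1) • G.d u)
    let X : G.Word ((n + 1) • G.d u) → G.modularFixed := fun w =>
      ⟨star (G.s w) * G.mono u v * G.s w, conj_star_mem_modularFixed h w⟩
    have hX : ∀ w, ‖X w‖ ≤ 1 := fun w => norm_star_s_mul_mono_mul_s_le u v w
    have huniq : ∀ w w', X w ≠ 0 → X w' ≠ 0 → w = w' := by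
      intro w w' hXw hXw'
      obtain ⟨α, hα, hdα, h1⟩ :=
        exists_of_star_s_mul_mono_mul_s_ne_zero w.2 fun h => hXw (Subtype.ext h)
      obtain ⟨α', hα', hdα', h1'⟩ :=
        exists_of_star_s_mul_mono_mul_s_ne_zero w'.2 fun h => hXw' (Subtype.ext h)
      refine Subtype.ext ?_
      rw [hα, hα', hG.eq_of_common_extension n huv hdα hdα' h1 h1']
    have hsum : ‖∑ w : G.Word ((n + 1) • G.d u),
        SingleVertexKGraph.compression φ (w : Λ) (X w)‖ ≤ 1 := by
      by_cases hex : ∃ w, X w ≠ 0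
      · obtain ⟨w, hXw⟩ := hex
        rw [Finset.sum_eq_single w]
        · exact ((hφ.compression hm w).norm_le _).trans (hX w)
        · intro w' _ hne
          have : X w' = 0 := by
            by_contra h0
            exact hne (huniq _ _ h0 hXw)
          rw [this, map_zero]
        · simp
      · push Not at hex
        simp [hex]
    rw [hφ.eq_sum_compression hm ((n + 1) • G.d u), norm_mul, norm_inv, Complex.norm_real,
      Real.norm_of_nonneg hw.le, inv_pow, ← weight_nsmul]
    exact mul_le_of_le_one_right (inv_nonneg.2 hw.le) hsum
  have hlt : (G.weight (G.d u))⁻¹ < 1 := inv_lt_one_of_one_lt₀ (one_lt_weight hm hu)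
  have hlim : Filter.Tendsto (fun n : ℕ => ((G.weight (G.d u))⁻¹) ^ (n + 1)) Filter.atTop
      (nhds 0) := (tendsto_pow_atTop_nhds_zero_of_lt_one
        (inv_nonneg.2 (G.weight_pos hm _).le) hlt).comp (Filter.tendsto_add_atTop_nat 1)
  exact norm_le_zero_iff.1 (ge_of_tendsto' hlim hbound)

/-- Split off prefixes `a`, `b` of degree `d(u) ∧ d(v)`. If `a = b`, the value is a multiple of that
of the compressed trace on a monomial without common colours; if `a ≠ b`, cycling the projection
`s_a s_a^*` through the trace gives zero. -/
lemma IsTracialState.map_mono_of_littlePullback (hm : ∀ i, 1 < G.m i) (hG : G.LittlePullback)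
    {φ : G.modularFixed →ₗ[ℂ] ℂ} (hφ : IsTracialState φ) {u v : Λ}
    (hw : G.weight (G.d u) = G.weight (G.d v)) (hd : G.d u ≠ G.d v)
    (h : G.mono u v ∈ G.modularFixed) : φ ⟨G.mono u v, h⟩ = 0 := by
  obtain ⟨a, u', rfl, ha, hu'⟩ := G.exists_factor (w := u) (p := G.d u ⊓ G.d v) inf_le_left
  obtain ⟨b, v', rfl, hb, hv'⟩ := G.exists_factor (w := v) (p := G.d (a * u') ⊓ G.d v) inf_le_right
  have hab : G.d a = G.d b := ha.trans hb.symm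
  by_cases h1 : a = b
  · subst h1
    have hw' : G.weight (G.d u') = G.weight (G.d v') := by
      rw [G.d_mul, G.d_mul, weight_add, weight_add] at hw
      exact mul_left_cancel₀ (G.weight_pos hm _).ne' hw
    have hdisj : ∀ i, G.d u' i = 0 ∨ G.d v' i = 0 := fun i => by
      rw [hu', hv']
      simp only [Pi.sub_apply, Pi.inf_apply]
      omega
    have hne : G.d u' ≠ 0 := by
      intro h0
      have h2 : G.d v' = 0 := by
        by_contra hne
        have := one_lt_weight hm hne
        rw [← hw', h0, weight_zero] at this
        exact lt_irrefl _ this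
      exact hd (by rw [G.d_mul, G.d_mul, h0, h2])
    have hmem := mono_mem_modularFixed hm hw'
    have h3 := (hφ.compression hm a).map_mono_of_disjoint hm hG hdisj hne hmem
    have h4 := (mul_eq_zero.1 h3).resolve_left (by exact_mod_cast (G.weight_pos hm _).ne')
    have h5 : (⟨G.mono (a * u') (a * v'), h⟩ : G.modularFixed) =
        ⟨G.s a * G.mono u' v' * star (G.s a), conj_mem_modularFixed hmem a⟩ :=
      Subtype.ext <| by
        change G.mono (a * u') (a * v') = G.s a * G.mono u' v' * star (G.s a)
        rw [s_mul_mono, mono_mul_star_s]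
    rw [h5]
    exact h4
  · have hmem : G.mono a a ∈ G.modularFixed := G.core_le_modularFixed (G.mono_mem_core rfl)
    have e1 : (⟨G.mono (a * u') (b * v'), h⟩ : G.modularFixed) =
        ⟨G.mono a a, hmem⟩ * ⟨G.mono (a * u') (b * v'), h⟩ := Subtype.ext <| Eq.symm <| by
      calc G.mono a a * G.mono (a * u') (b * v')
          = G.s a * (star (G.s a) * G.s (a * u')) * star (G.s (b * v')) := by
            simp only [mono, mul_assoc]
        _ = G.mono (a * u') (b * v') := by
            rw [G.s_isCuntzType.star_mul_mul, ← map_mul]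
            rfl
    have e2 : (⟨G.mono (a * u') (b * v'), h⟩ : G.modularFixed) * ⟨G.mono a a, hmem⟩ = 0 :=
      Subtype.ext <| by
        change G.mono (a * u') (b * v') * G.mono a a = 0
        rw [mono, mono, mul_assoc, ← mul_assoc (star (G.s (b * v'))), map_mul G.s b, star_mul,
          mul_assoc (star (G.s v')), G.s_isCuntzType.star_mul_of_ne_word hab.symm (Ne.symm h1),
          mul_zero, zero_mul, mul_zero]
    rw [e1, hφ.tracial, e2, map_zero]

end Compression

/-! ### Uniqueness of the trace on the modular fixed points. -/

section Uniqueness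

variable {G}

lemma d_eq_of_finrank_intrinsicGroup (hm : ∀ i, 1 < G.m i)
    (h : Module.finrank ℤ G.intrinsicGroup = 0) {u v : Λ}
    (hw : G.weight (G.d u) = G.weight (G.d v)) : G.d u = G.d v := by
  -- Finite generation is needed because `Module.finrank` is also zero for modules of infinite rank.
  have : Module.Finite ℤ G.intrinsicGroup :=
    Module.Finite.of_injective G.intrinsicGroup.subtype.toIntLinearMap Subtype.val_injective
  have hs : Subsingleton G.intrinsicGroup := Module.finrank_zero_iff.1 h
  have hmem : (fun i => (G.d u i : ℤ) - G.d v i) ∈ G.intrinsicGroup := by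
    change ∏ i, (G.m i : ℝ) ^ ((G.d u i : ℤ) - G.d v i) = 1
    have hne : ∀ i, (G.m i : ℝ) ≠ 0 := fun i => by
      have := hm i
      exact_mod_cast (by omega : G.m i ≠ 0)
    simp only [zpow_sub₀ (hne _), zpow_natCast, Finset.prod_div_distrib]
    exact (div_eq_one_iff_eq (G.weight_pos hm _).ne').2 hw
  have h0 := congrArg Subtype.val (Subsingleton.elim (⟨_, hmem⟩ : G.intrinsicGroup) 0)
  funext i
  have := congrFun h0 i
  have h1 : (G.d u i : ℤ) - G.d v i = 0 := this
  omega

lemma tracialState_modularFixed_unique (hm : ∀ i, 1 < G.m i)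
    (h : G.LittlePullback ∨ Module.finrank ℤ G.intrinsicGroup = 0)
    {φ ψ : G.modularFixed →ₗ[ℂ] ℂ} (hφ : IsTracialState φ) (hψ : IsTracialState ψ) : φ = ψ := by
  have := isClosed_modularFixed (G := G)
  refine functional_ext hφ.norm_le hψ.norm_le
    (s := {x | ∃ u v, G.weight (G.d u) = G.weight (G.d v) ∧ x = G.mono u v})
    (by rintro _ ⟨u, v, h, rfl⟩; exact mono_mem_modularFixed hm h)
    (fun a ha => mem_closure_of_mem_modularFixed hm ha) ?_
  rintro _ ⟨u, v, hw, rfl⟩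
  by_cases hd : G.d u = G.d v
  · by_cases huv : u = v
    · subst huv
      rw [hφ.map_mono_self G.core_le_modularFixed, hψ.map_mono_self G.core_le_modularFixed]
    · rw [hφ.map_mono_of_ne G.core_le_modularFixed hd huv,
        hψ.map_mono_of_ne G.core_le_modularFixed hd huv]
  · rcases h with hG | hr
    · rw [hφ.map_mono_of_littlePullback hm hG hw hd, hψ.map_mono_of_littlePullback hm hG hw hd]
    · exact absurd (d_eq_of_finrank_intrinsicGroup hm hr hw) hd

end Uniqueness

end SingleVertexKGraph

/-! ### Assembly of the traces `τ` and `ρ`. -/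

theorem mainTheorem3 {k : ℕ} {Λ : Type*} [Monoid Λ] (G : SingleVertexKGraph k Λ)
    (hm : ∀ i, 1 < G.m i)
    (h : G.LittlePullback ∨ Module.finrank ℤ G.intrinsicGroup = 0) :
    ∃ τ : G.core →ₗ[ℂ] ℂ,
      -- `τ` is the unique tracial state of the core
      (SingleVertexKGraph.IsTracialState τ ∧
        ∀ τ' : G.core →ₗ[ℂ] ℂ, SingleVertexKGraph.IsTracialState τ' → τ' = τ) ∧
      -- `σ` is the modular action of `ω = τ ∘ Φ₀`
      SingleVertexKGraph.IsModularGroup (G.omega τ) G.modularFlow ∧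
      -- the fixed point algebra has a unique tracial state, and it extends `τ`
      ∃ ρ : G.modularFixed →ₗ[ℂ] ℂ,
        SingleVertexKGraph.IsTracialState ρ ∧
        (∀ ρ' : G.modularFixed →ₗ[ℂ] ℂ, SingleVertexKGraph.IsTracialState ρ' → ρ' = ρ) ∧
        ∀ a : G.core,
          ρ (StarSubalgebra.inclusion G.core_le_modularFixed a) = τ a := by
  obtain ⟨L, hL, hcentral⟩ := SingleVertexKGraph.exists_central_state (G := G) hm
  have hτ := hL.isTracialState_comp_subtype (B := G.core)
    (fun _ ha => G.mem_closure_of_mem_core ha) hcentral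
  have hω := SingleVertexKGraph.isGaugeTrace_comp_expectation hτ
  have hωs := G.isState_comp_expectation hL
  -- The trace `ρ` is the restriction of `ω`: equal weights make the factor in
  -- `IsGaugeTrace.mono_mul` equal to `1`.
  have hρ := hωs.isTracialState_comp_subtype (B := G.modularFixed)
    (fun _ ha => SingleVertexKGraph.mem_closure_of_mem_modularFixed hm ha) fun u v huv b => by
      have hne : (G.weight (G.d v) : ℂ) ≠ 0 := by exact_mod_cast (G.weight_pos hm _).ne'
      rw [hω.mono_mul hm, huv, div_self hne, one_mul]
  refine ⟨_, ⟨hτ, fun τ' hτ' => SingleVertexKGraph.tracialState_core_unique hτ' hτ⟩, ?_, _, hρ,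
    fun ρ' hρ' => SingleVertexKGraph.tracialState_modularFixed_unique hm h hρ' hρ, fun a => ?_⟩
  · exact SingleVertexKGraph.isModularGroup_of_isGaugeTrace hm hω hωs.norm_le
      fun t a => congrArg L (G.expectation_gauge t a)
  -- The trace `ρ` extends `τ` because the expectation is the identity on the core.
  · exact congrArg L (G.expectation_of_mem_core a.2)
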